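/- Notation: $(x;p)_n=\prod_{j=0}^{n-1}(1-xp^j)$, $(x;p)_\infty=\prod_{j\ge 0}(1-xp^j)$, and $1/(p;p)_n=0$ for negative integers $n$. **Theorem 4.3.** For every integer $k\ge 0$, $$\frac{1}{(aq;q)_\infty}\sum_{r=0}^\infty \frac{a^{2r}q^{2r^2+2^k\binom r2}\,(1-a^{2^k}q^{r2^{k+1}})\,(a^{2^k};q^{2^k})_r\,(-1)^r}{(1-a^{2^k})\,(q^{2^k};q^{2^k})_r} =\sum_{s_1,\dots,s_{k+1}\ge 0}\frac{a^{s_1+s_2}q^{E}}{(q;q)_{s_1-s_2}}\prod_{i=3}^{k+2}\frac{(-a^{2^{i-3}}q^{2^{i-3}};q^{2^{i-3}})_{2s_i}}{(q^{2^{i-2}};q^{2^{i-2}})_{s_{i-1}-s_i}},$$ where $s_{k+2}=0$ and $$E=s_1^2+s_2^2+s_2+\sum_{i=3}^{k+1}2^{i-3}s_i=s_1^2+s_2^2+s_2+s_3+2s_4+\cdots+2^{k-2}s_{k+1}$$ (for $k=0$ the right-hand side is $\sum_{s_1\ge0}a^{s_1}q^{s_1^2}/(q;q)_{s_1}$). If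 $a^{2^k}=1$, the quotient $\frac{(1-a^{2^k}q^{r2^{k+1}})(a^{2^k};q^{2^k})_r}{(1-a^{2^k})(q^{2^k};q^{2^k})_r}$ is understood as its limit, which is $1$ for $r=0$ and $1+q^{2^kr}$ for $r\ge1$. The identity holds in each of the following senses. 1. Formally: for every field $K$ and every $a\in K$ (for example an indeterminate $a$, with $K=\mathbb Q(a)$), it is an identity in $K[[q]]$. The infinite product and both sums converge coefficientwise, and the product is invertible. 2. Analytically: it holds for all complex $a,q$ with $|q|<1$ and $aq^n\ne1$ for all $n\ge1$. The infinite product converges to a nonzero number and both sums converge absolutely. -/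

import Mathlib

open scoped PowerSeries PowerSeries.WithPiTopology

noncomputable section

/-- The `q`-shifted factorial `(x; p)_n = (1 - x) (1 - x p) ⋯ (1 - x p ^ (n - 1))`. -/
def qPoch {R : Type*} [CommRing R] (x p : R) (n : ℕ) : R :=
  ∏ j ∈ Finset.range n, (1 - x * p ^ j)

/-- The reciprocal `1 / (p; p)_{m - n}`, where the subscript is the integer `m - n`. By the usual
convention it is `0` if the subscript is negative. (`Ring.inverse u` is the inverse of `u` if `u` is
a unit, which is the case for all the denominators below.) -/
def qPochRecip {R : Type*} [CommRing R] (p : R) (m n : ℕ) : R :=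
  if n ≤ m then Ring.inverse (qPoch p p (m - n)) else 0

open Classical in
/-- The quotient
`(1 - a^(2^k) q^(r 2^(k+1))) (a^(2^k); q^(2^k))_r / ((1 - a^(2^k)) (q^(2^k); q^(2^k))_r)`.
At the removable singularity `a^(2^k) = 1` it is understood as its limit, which is `1` for `r = 0`
and `1 + q^(2^k r)` for `r > 0`. -/
def seriesFactor {R : Type*} [CommRing R] (k : ℕ) (a q : R) (r : ℕ) : R :=
  if a ^ 2 ^ k = 1 then
    if r = 0 then 1 else 1 + q ^ (2 ^ k * r)
  else
    (1 - a ^ 2 ^ k * q ^ (r * 2 ^ (k + 1))) * qPoch (a ^ 2 ^ k) (q ^ 2 ^ k) r *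
      Ring.inverse ((1 - a ^ 2 ^ k) * qPoch (q ^ 2 ^ k) (q ^ 2 ^ k) r)

/-- The `r`-th term of the single series. -/
def seriesTerm {R : Type*} [CommRing R] (k : ℕ) (a q : R) (r : ℕ) : R :=
  a ^ (2 * r) * q ^ (2 * r ^ 2 + 2 ^ k * r.choose 2) * (-1) ^ r * seriesFactor k a q r

/-- The summation indices `s_1, …, s_{k+1}`, numbered from `1`, with `s_i = 0` for `i > k + 1`
(in particular `s_{k+2} = 0`). -/
def idx {k : ℕ} (s : Fin (k + 1) → ℕ) (i : ℕ) : ℕ :=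
  if h : 1 ≤ i ∧ i ≤ k + 1 then s ⟨i - 1, by omega⟩ else 0

/-- The exponent `E = s_1² + s_2² + s_2 + s_3 + 2 s_4 + ⋯ + 2^(k-2) s_{k+1}`. -/
def multiExponent {k : ℕ} (s : Fin (k + 1) → ℕ) : ℕ :=
  idx s 1 ^ 2 + idx s 2 ^ 2 + idx s 2 + ∑ i ∈ Finset.Icc 3 (k + 1), 2 ^ (i - 3) * idx s i

/-- The term of the multisum with indices `s_1, …, s_{k+1}`. -/
def multiTerm {R : Type*} [CommRing R] (k : ℕ) (a q : R) (s : Fin (k + 1) → ℕ) : R :=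
  a ^ (idx s 1 + idx s 2) * q ^ multiExponent s * qPochRecip q (idx s 1) (idx s 2) *
    ∏ i ∈ Finset.Icc 3 (k + 2),
      (qPoch (-(a ^ 2 ^ (i - 3) * q ^ 2 ^ (i - 3))) (q ^ 2 ^ (i - 3)) (2 * idx s i) *
        qPochRecip (q ^ 2 ^ (i - 2)) (idx s (i - 1)) (idx s i))

end

/-! ### Finite summations and Bailey pairs over a commutative ring. -/

section Finite

open Finset.HasAntidiagonal (antidiagonal mem_antidiagonal)

variable {R : Type*} [CommRing R]

/-! The identity is the limit n → ∞ of a finite one obtained from Bailey pairs. Start with the unit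
Bailey pair relative to (a^(2^k), q^(2^k)) (`isBaileyPair_unit`). A change of base of
Bressoud–Ismail–Stanton type, (a², q²) → (a, q), keeps α and turns β into a single sum
(`IsBaileyPair.changeOfBase`). Applied k times, it yields the sums over s_3, …, s_{k+2}, where the
unit pair forces s_{k+2} = 0. Two steps along the Bailey chain in base q (`IsBaileyPair.chain`) then
multiply α_r by a^(2r) q^(2r²) and add the sums over s_1 and s_2. Writing out the resulting pair at
n gives `sum_multiTerm_eq_sum_seriesTerm`.

Both transformations rest on `qVandermonde`. Bailey pairs are normalised by γ_n = (aq; q)_{2n} β_n,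
so no factor 1 - a q^j is ever inverted: the finite identity only needs the 1 - q^(n+1) to be units,
together with the dichotomy at a^(2^k) = 1, and so serves power series and complex numbers alike.

For the limit, both sides are multiplied by (q; q)_n. Each term of either sum then carries a
multiplier tending to 1, and (aq; q)_{2n} tends to the infinite product. Sum and limit are
interchanged X-adically in `PowerSeries.exists_hasSum_of_X_pow_dvd` and by dominated convergence in
`tendsto_sum_mul`. -/

@[simp] lemma qPoch_zero (x p : R) : qPoch x p 0 = 1 := by simp [qPoch]

lemma qPoch_succ (x p : R) (n : ℕ) : qPoch x p (n + 1) = qPoch x p n * (1 - x * p ^ n) := by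
  simp [qPoch, Finset.prod_range_succ]

lemma qPoch_succ' (x p : R) (n : ℕ) : qPoch x p (n + 1) = (1 - x) * qPoch (x * p) p n := by
  simp only [qPoch, Finset.prod_range_succ', pow_zero, mul_one, pow_succ']
  rw [mul_comm]
  simp only [mul_assoc]

lemma qPoch_add (x p : R) (m n : ℕ) :
    qPoch x p (m + n) = qPoch x p m * qPoch (x * p ^ m) p n := by
  simp only [qPoch, Finset.prod_range_add, pow_add, mul_assoc]

/-- `(x; p)_n (-x; p)_n = (x²; p²)_n`. -/
lemma qPoch_mul_qPoch_neg (x p : R) (n : ℕ) :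
    qPoch x p n * qPoch (-x) p n = qPoch (x ^ 2) (p ^ 2) n := by
  simp only [qPoch, ← Finset.prod_mul_distrib]
  exact Finset.prod_congr rfl fun j _ => by ring

/-- The reciprocal `1 / (q; q)_n`. -/
noncomputable def qPochInv (q : R) (n : ℕ) : R := Ring.inverse (qPoch q q n)

@[simp] lemma qPochInv_zero (q : R) : qPochInv q 0 = 1 := by simp [qPochInv]

variable {q : R}

lemma isUnit_qPoch (hq : ∀ n : ℕ, IsUnit (1 - q ^ (n + 1))) (n : ℕ) : IsUnit (qPoch q q n) := by
  induction n with
  | zero => simp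
  | succ n ih => rw [qPoch_succ, ← pow_succ']; exact ih.mul (hq n)

lemma qPoch_mul_qPochInv (hq : ∀ n : ℕ, IsUnit (1 - q ^ (n + 1))) (n : ℕ) :
    qPoch q q n * qPochInv q n = 1 :=
  Ring.mul_inverse_cancel _ (isUnit_qPoch hq n)

lemma qPochInv_eq (hq : ∀ n : ℕ, IsUnit (1 - q ^ (n + 1))) (n : ℕ) :
    qPochInv q n = (1 - q ^ (n + 1)) * qPochInv q (n + 1) := by
  have h1 := qPoch_mul_qPochInv hq n
  have h2 := qPoch_mul_qPochInv hq (n + 1)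
  rw [qPoch_succ] at h2
  linear_combination ((1 - q ^ (n + 1)) * qPochInv q (n + 1)) * h1 - qPochInv q n * h2

lemma isUnit_one_sub_sq (hq : ∀ n : ℕ, IsUnit (1 - q ^ (n + 1))) (n : ℕ) :
    IsUnit (1 - (q ^ 2) ^ (n + 1)) := by
  have := hq (2 * n + 1)
  rwa [← pow_mul, show 2 * (n + 1) = 2 * n + 1 + 1 by ring]

/-- `1 - q^(i+j) = (1 - q^i) + q^i (1 - q^j)` lowers the size of an antidiagonal sum. -/
lemma one_sub_pow_mul_sum_antidiagonal (hq : ∀ n : ℕ, IsUnit (1 - q ^ (n + 1)))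
    (A : ℕ → ℕ → R) (N : ℕ) :
    (1 - q ^ (N + 1)) * ∑ x ∈ antidiagonal (N + 1),
        A x.1 x.2 * (qPochInv q x.1 * qPochInv q x.2) =
      ∑ x ∈ antidiagonal N,
        (A (x.1 + 1) x.2 + q ^ x.1 * A x.1 (x.2 + 1)) * (qPochInv q x.1 * qPochInv q x.2) := by
  have key : (1 - q ^ (N + 1)) * ∑ x ∈ antidiagonal (N + 1),
        A x.1 x.2 * (qPochInv q x.1 * qPochInv q x.2) =
      ∑ x ∈ antidiagonal (N + 1),
        (1 - q ^ x.1) * A x.1 x.2 * (qPochInv q x.1 * qPochInv q x.2) +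
      ∑ x ∈ antidiagonal (N + 1),
        q ^ x.1 * (1 - q ^ x.2) * A x.1 x.2 * (qPochInv q x.1 * qPochInv q x.2) := by
    rw [Finset.mul_sum, ← Finset.sum_add_distrib]
    refine Finset.sum_congr rfl fun x hx => ?_
    rw [← mem_antidiagonal.1 hx, pow_add]
    ring
  rw [key, Finset.Nat.sum_antidiagonal_succ, Finset.Nat.sum_antidiagonal_succ']
  simp only [pow_zero, sub_self, zero_mul, mul_zero, zero_add]
  rw [← Finset.sum_add_distrib]
  refine Finset.sum_congr rfl fun x _ => ?_
  rw [qPochInv_eq hq x.1, qPochInv_eq hq x.2]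
  ring

/-- A form of the `q`-Chu–Vandermonde sum without denominators in `a` and `b`. -/
lemma qVandermonde (hq : ∀ n : ℕ, IsUnit (1 - q ^ (n + 1))) (N : ℕ) (a b : R) :
    ∑ x ∈ antidiagonal N,
        b ^ x.1 * q ^ x.1 ^ 2 * qPoch (b * q ^ (x.1 + 1)) q x.2 * qPoch (a * q ^ (x.2 + 1)) q x.1 *
          (qPochInv q x.1 * qPochInv q x.2) =
      qPoch (a * b * q ^ (N + 1)) q N * qPochInv q N := by
  induction N generalizing a b with
  | zero => simp
  | succ N ih =>
    apply (hq N).mul_left_cancel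
    -- For these coefficients, A(i+1, j) + q^i A(i, j+1) is 1 - a b q^(N+2) times the coefficient
    -- for (a q, b q) at i + j = N.
    rw [one_sub_pow_mul_sum_antidiagonal hq (fun i j =>
      b ^ i * q ^ i ^ 2 * qPoch (b * q ^ (i + 1)) q j * qPoch (a * q ^ (j + 1)) q i)]
    have h := ih (a * q) (b * q)
    have hr : (1 - q ^ (N + 1)) * (qPoch (a * b * q ^ (N + 1 + 1)) q (N + 1) * qPochInv q (N + 1)) =
        (1 - a * b * q ^ (N + 2)) *
          (qPoch (a * q * (b * q) * q ^ (N + 1)) q N * qPochInv q N) := by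
      rw [qPochInv_eq hq N, qPoch_succ',
        show a * b * q ^ (N + 1 + 1) * q = a * q * (b * q) * q ^ (N + 1) by ring]
      ring
    rw [hr, ← h, Finset.mul_sum]
    refine Finset.sum_congr rfl fun x hx => ?_
    rw [← mem_antidiagonal.1 hx, qPoch_succ', qPoch_succ',
      show b * q ^ (x.1 + 1) * q = b * q * q ^ (x.1 + 1) by ring,
      show a * q ^ (x.2 + 1) * q = a * q * q ^ (x.2 + 1) by ring,
      show b * q ^ (x.1 + 1 + 1) = b * q * q ^ (x.1 + 1) by ring,
      show a * q ^ (x.2 + 1 + 1) = a * q * q ^ (x.2 + 1) by ring]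
    ring

/-- Euler: the generating functions of the two factors are (zq; q²)_∞ and its reciprocal. In the
proof, the two contributions from splitting 1 - q^(2(N+1)) cancel term by term. -/
lemma sum_antidiagonal_neg_one_pow (hq : ∀ n : ℕ, IsUnit (1 - q ^ (n + 1))) (N : ℕ) :
    ∑ x ∈ antidiagonal N, (-1) ^ x.1 * q ^ (x.1 ^ 2 + x.2) *
        (qPochInv (q ^ 2) x.1 * qPochInv (q ^ 2) x.2) = if N = 0 then 1 else 0 := by
  cases N with
  | zero => simp
  | succ N =>
    have hq2 := isUnit_one_sub_sq hq
    apply (hq2 N).mul_left_cancel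
    rw [one_sub_pow_mul_sum_antidiagonal hq2 (fun i j => (-1) ^ i * q ^ (i ^ 2 + j))]
    simp only [Nat.add_eq_zero_iff, one_ne_zero, and_false, if_false, mul_zero]
    refine Finset.sum_eq_zero fun x _ => ?_
    ring

/-- Both sides run over the triples of sum n; the first two entries are exchanged. -/
lemma sum_antidiagonal_comm_assoc (f : ℕ → ℕ → ℕ → R) (n : ℕ) :
    ∑ x ∈ antidiagonal n, ∑ y ∈ antidiagonal x.2, f x.1 y.1 y.2 =
      ∑ x ∈ antidiagonal n, ∑ y ∈ antidiagonal x.2, f y.1 x.1 y.2 := by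
  simp only [Finset.sum_sigma']
  refine Finset.sum_nbij' (fun x => ⟨(x.2.1, x.1.1 + x.2.2), (x.1.1, x.2.2)⟩)
    (fun x => ⟨(x.2.1, x.1.1 + x.2.2), (x.1.1, x.2.2)⟩) ?_ ?_ ?_ ?_ ?_
  · rintro ⟨⟨i, j⟩, ⟨k, l⟩⟩ h
    simp only [Finset.mem_sigma, mem_antidiagonal] at h ⊢
    exact ⟨by omega, trivial⟩
  · rintro ⟨⟨i, j⟩, ⟨k, l⟩⟩ h
    simp only [Finset.mem_sigma, mem_antidiagonal] at h ⊢
    exact ⟨by omega, trivial⟩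
  · rintro ⟨⟨i, j⟩, ⟨k, l⟩⟩ h
    simp only [Finset.mem_sigma, mem_antidiagonal] at h
    obtain ⟨-, rfl⟩ := h
    rfl
  · rintro ⟨⟨i, j⟩, ⟨k, l⟩⟩ h
    simp only [Finset.mem_sigma, mem_antidiagonal] at h
    obtain ⟨-, rfl⟩ := h
    rfl
  · rintro ⟨⟨i, j⟩, ⟨k, l⟩⟩ h
    rfl

lemma qPochInv_eq_qPochInv_sq_mul (hq : ∀ n : ℕ, IsUnit (1 - q ^ (n + 1))) (n : ℕ) :
    qPochInv q n = qPochInv (q ^ 2) n * qPoch (-q) q n := by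
  have h1 := qPoch_mul_qPochInv hq n
  have h2 := qPoch_mul_qPochInv (isUnit_one_sub_sq hq) n
  rw [← qPoch_mul_qPoch_neg] at h2
  linear_combination (qPochInv (q ^ 2) n * qPoch (-q) q n) * h1 - qPochInv q n * h2

/-- This is `qVandermonde` at b = -1, after cancelling (-q; q)_N, a unit because it divides (q²;
q²)_N. -/
lemma qPochInv_sq_mul_qPoch_neg (hq : ∀ n : ℕ, IsUnit (1 - q ^ (n + 1))) (N : ℕ) (a : R) :
    qPochInv (q ^ 2) N * qPoch (-(a * q ^ (N + 1))) q N =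
      ∑ x ∈ antidiagonal N, (-1) ^ x.1 * q ^ x.1 ^ 2 * qPoch (a * q ^ (x.2 + 1)) q x.1 *
        (qPochInv (q ^ 2) x.1 * qPochInv q x.2) := by
  have hu : IsUnit (qPoch (-q) q N) := by
    have := isUnit_qPoch (isUnit_one_sub_sq hq) N
    rw [← qPoch_mul_qPoch_neg] at this
    exact isUnit_of_mul_isUnit_right this
  apply hu.mul_left_cancel
  have h := qVandermonde hq N a (-1)
  rw [show a * -1 * q ^ (N + 1) = -(a * q ^ (N + 1)) by ring,
    qPochInv_eq_qPochInv_sq_mul hq N] at h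
  rw [← mul_assoc, mul_comm (qPoch _ q N) (qPochInv _ N), mul_comm, ← h, Finset.mul_sum]
  refine Finset.sum_congr rfl fun x hx => ?_
  have hx := mem_antidiagonal.1 hx
  rw [qPochInv_eq_qPochInv_sq_mul hq x.1, ← hx, qPoch_add (-q),
    show -q * q ^ x.1 = -1 * q ^ (x.1 + 1) by ring]
  ring

/-- The summation behind the change of base `(a², q²) → (a, q)`. -/
lemma changeOfBase_sum (hq : ∀ n : ℕ, IsUnit (1 - q ^ (n + 1))) (N : ℕ) (a : R) :
    ∑ x ∈ antidiagonal N, q ^ x.1 * qPochInv (q ^ 2) x.1 * qPochInv (q ^ 2) x.2 *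
        qPoch (a * q ^ (x.2 + 1)) q x.1 * qPoch (-(a * q ^ (x.2 + 1))) q x.2 = qPochInv q N := by
  -- The shifted factorial depends on u and i only through u + i. Once v is made the outer index,
  -- the inner sum is that of `sum_antidiagonal_neg_one_pow`, and only v = N survives.
  obtain ⟨F, hF⟩ : ∃ F : ℕ → ℕ → ℕ → R, F =
      fun i v u => (-1) ^ u * q ^ (u ^ 2 + i) * qPoch (a * q ^ (v + 1)) q (u + i) *
          qPochInv q v * (qPochInv (q ^ 2) u * qPochInv (q ^ 2) i) :=
    ⟨_, rfl⟩
  have h1 : ∑ x ∈ antidiagonal N, q ^ x.1 * qPochInv (q ^ 2) x.1 * qPochInv (q ^ 2) x.2 *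
        qPoch (a * q ^ (x.2 + 1)) q x.1 * qPoch (-(a * q ^ (x.2 + 1))) q x.2 =
      ∑ x ∈ antidiagonal N, ∑ y ∈ antidiagonal x.2,
        F x.1 y.1 y.2 := by
    refine Finset.sum_congr rfl fun x _ => ?_
    have := qPochInv_sq_mul_qPoch_neg hq x.2 a
    rw [← Finset.Nat.sum_antidiagonal_swap] at this
    calc _ = q ^ x.1 * qPochInv (q ^ 2) x.1 * qPoch (a * q ^ (x.2 + 1)) q x.1 *
          (qPochInv (q ^ 2) x.2 * qPoch (-(a * q ^ (x.2 + 1))) q x.2) := by ring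
      _ = _ := by
        rw [this, Finset.mul_sum]
        refine Finset.sum_congr rfl fun y hy => ?_
        rw [← mem_antidiagonal.1 hy]
        simp only [hF, Prod.fst_swap, Prod.snd_swap]
        rw [qPoch_add _ _ y.2, show a * q ^ (y.1 + 1) * q ^ y.2 = a * q ^ (y.1 + y.2 + 1) by ring]
        ring
  rw [h1, sum_antidiagonal_comm_assoc]
  have h2 : ∀ x ∈ antidiagonal N, ∑ y ∈ antidiagonal x.2,
        F y.1 x.1 y.2 =
      qPoch (a * q ^ (x.1 + 1)) q x.2 * qPochInv q x.1 * if x.2 = 0 then 1 else 0 := by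
    intro x _
    rw [← sum_antidiagonal_neg_one_pow hq, ← Finset.Nat.sum_antidiagonal_swap, Finset.mul_sum]
    refine Finset.sum_congr rfl fun y hy => ?_
    rw [← mem_antidiagonal.1 hy]
    simp only [hF, Prod.fst_swap, Prod.snd_swap]
    ring
  rw [Finset.sum_congr rfl h2]
  rw [Finset.sum_eq_single (N, 0)]
  · simp
  · rintro ⟨i, j⟩ hij hne
    rw [mem_antidiagonal] at hij
    rw [if_neg, mul_zero]
    rintro rfl
    exact hne (by simpa using hij)
  · simp

/-- `γ n = (a q; q)_{2n} β_n` for a Bailey pair `(α, β)` relative to `(a, q)`. -/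
def IsBaileyPair (a q : R) (α γ : ℕ → R) : Prop :=
  ∀ n, γ n = ∑ x ∈ antidiagonal n,
    α x.1 * qPoch (a * q ^ (2 * x.1 + x.2 + 1)) q x.2 * qPochInv q x.2

lemma IsBaileyPair.changeOfBase (hq : ∀ n : ℕ, IsUnit (1 - q ^ (n + 1))) {a : R} {α γ : ℕ → R}
    (h : IsBaileyPair (a ^ 2) (q ^ 2) α γ) :
    IsBaileyPair a q α fun n => ∑ x ∈ antidiagonal n,
      qPoch (a * q ^ (2 * x.2 + 1)) q (2 * x.1) * q ^ x.1 * qPochInv (q ^ 2) x.1 * γ x.2 := by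
  intro n
  obtain ⟨F, hF⟩ : ∃ F : ℕ → ℕ → ℕ → R, F =
      fun i r m => qPoch (a * q ^ (2 * (r + m) + 1)) q (2 * i) * q ^ i * qPochInv (q ^ 2) i *
            (α r * qPoch (a ^ 2 * (q ^ 2) ^ (2 * r + m + 1)) (q ^ 2) m * qPochInv (q ^ 2) m) :=
    ⟨_, rfl⟩
  calc ∑ x ∈ antidiagonal n,
      qPoch (a * q ^ (2 * x.2 + 1)) q (2 * x.1) * q ^ x.1 * qPochInv (q ^ 2) x.1 * γ x.2
      = ∑ x ∈ antidiagonal n, ∑ y ∈ antidiagonal x.2,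
          F x.1 y.1 y.2 := by
        refine Finset.sum_congr rfl fun x _ => ?_
        rw [h x.2, Finset.mul_sum]
        refine Finset.sum_congr rfl fun y hy => ?_
        simp only [hF, ← mem_antidiagonal.1 hy]
    _ = _ := by
        rw [sum_antidiagonal_comm_assoc]
        refine Finset.sum_congr rfl fun x _ => ?_
        rw [← changeOfBase_sum hq x.2 (a * q ^ (2 * x.1)), Finset.mul_sum]
        refine Finset.sum_congr rfl fun y hy => ?_
        have hy := mem_antidiagonal.1 hy
        have e1 : qPoch (a ^ 2 * (q ^ 2) ^ (2 * x.1 + y.2 + 1)) (q ^ 2) y.2 =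
            qPoch (a * q ^ (2 * x.1) * q ^ (y.2 + 1)) q y.2 *
              qPoch (-(a * q ^ (2 * x.1) * q ^ (y.2 + 1))) q y.2 := by
          rw [qPoch_mul_qPoch_neg]
          congr 1
          ring
        -- Both products are the same run of consecutive factors, cut at different places.
        have e2 : qPoch (a * q ^ (2 * x.1) * q ^ (y.2 + 1)) q y.2 *
            qPoch (a * q ^ (2 * (x.1 + y.2) + 1)) q (2 * y.1) =
            qPoch (a * q ^ (2 * x.1) * q ^ (y.2 + 1)) q y.1 *
              qPoch (a * q ^ (2 * x.1 + x.2 + 1)) q x.2 := by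
          rw [← hy, show a * q ^ (2 * x.1 + (y.1 + y.2) + 1) =
            a * q ^ (2 * x.1) * q ^ (y.2 + 1) * q ^ y.1 by ring, ← qPoch_add,
            show a * q ^ (2 * (x.1 + y.2) + 1) =
              a * q ^ (2 * x.1) * q ^ (y.2 + 1) * q ^ y.2 by ring, ← qPoch_add]
          congr 1
          ring
        simp only [hF]
        rw [e1]
        linear_combination (q ^ y.1 * qPochInv (q ^ 2) y.1 * α x.1 * qPochInv (q ^ 2) y.2 *
          qPoch (-(a * q ^ (2 * x.1) * q ^ (y.2 + 1))) q y.2) * e2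

/-- Bailey's lemma with both parameters sent to infinity. After interchanging sums, the inner one is
`qVandermonde` with first parameter 0 and second parameter a q^(2r). -/
lemma IsBaileyPair.chain (hq : ∀ n : ℕ, IsUnit (1 - q ^ (n + 1))) {a : R} {α γ : ℕ → R}
    (h : IsBaileyPair a q α γ) :
    IsBaileyPair a q (fun r => a ^ r * q ^ r ^ 2 * α r) fun n => ∑ x ∈ antidiagonal n,
      qPoch (a * q ^ (2 * x.2 + 1)) q (2 * x.1) * qPochInv q x.1 *
        (a ^ x.2 * q ^ x.2 ^ 2 * γ x.2) := by
  intro n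
  obtain ⟨F, hF⟩ : ∃ F : ℕ → ℕ → ℕ → R, F =
      fun i r m => qPoch (a * q ^ (2 * (r + m) + 1)) q (2 * i) * qPochInv q i *
            (a ^ (r + m) * q ^ (r + m) ^ 2 *
              (α r * qPoch (a * q ^ (2 * r + m + 1)) q m * qPochInv q m)) :=
    ⟨_, rfl⟩
  calc ∑ x ∈ antidiagonal n, qPoch (a * q ^ (2 * x.2 + 1)) q (2 * x.1) * qPochInv q x.1 *
        (a ^ x.2 * q ^ x.2 ^ 2 * γ x.2)
      = ∑ x ∈ antidiagonal n, ∑ y ∈ antidiagonal x.2,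
          F x.1 y.1 y.2 := by
        refine Finset.sum_congr rfl fun x _ => ?_
        rw [h x.2, Finset.mul_sum, Finset.mul_sum]
        refine Finset.sum_congr rfl fun y hy => ?_
        simp only [hF, ← mem_antidiagonal.1 hy]
    _ = _ := by
        rw [sum_antidiagonal_comm_assoc]
        refine Finset.sum_congr rfl fun x _ => ?_
        have hV := qVandermonde hq x.2 0 (a * q ^ (2 * x.1))
        simp only [zero_mul] at hV
        have h0 : ∀ m : ℕ, qPoch (0 : R) q m = 1 := fun m => by simp [qPoch]
        simp only [h0, mul_one, one_mul] at hV
        rw [← hV, ← Finset.Nat.sum_antidiagonal_swap, Finset.mul_sum]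
        refine Finset.sum_congr rfl fun y hy => ?_
        have hy := mem_antidiagonal.1 hy
        have e2 : qPoch (a * q ^ (2 * x.1 + y.1 + 1)) q y.1 *
            qPoch (a * q ^ (2 * (x.1 + y.1) + 1)) q (2 * y.2) =
            qPoch (a * q ^ (2 * x.1) * q ^ (y.1 + 1)) q y.2 *
              qPoch (a * q ^ (2 * x.1 + x.2 + 1)) q x.2 := by
          rw [← hy, show a * q ^ (2 * x.1 + (y.1 + y.2) + 1) =
            a * q ^ (2 * x.1) * q ^ (y.1 + 1) * q ^ y.2 by ring, ← qPoch_add,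
            show a * q ^ (2 * (x.1 + y.1) + 1) =
              a * q ^ (2 * x.1 + y.1 + 1) * q ^ y.1 by ring, ← qPoch_add,
            show a * q ^ (2 * x.1 + y.1 + 1) = a * q ^ (2 * x.1) * q ^ (y.1 + 1) by ring]
          congr 1
          ring
        simp only [hF, Prod.fst_swap, Prod.snd_swap]
        linear_combination (qPochInv q y.2 * a ^ (x.1 + y.1) * q ^ (x.1 + y.1) ^ 2 * α x.1 *
          qPochInv q y.1) * e2

/-- The quotient `(1 - a q^(2r)) (a; q)_r / ((1 - a) (q; q)_r)`, with `1 - a` cancelled. -/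
noncomputable def wellPoised (a q : R) : ℕ → R
  | 0 => 1
  | r + 1 => (1 - a * q ^ (2 * (r + 1))) * qPoch (a * q) q r * qPochInv q (r + 1)

/-- The unit Bailey pair. -/
lemma isBaileyPair_unit (hq : ∀ n : ℕ, IsUnit (1 - q ^ (n + 1))) (a : R) :
    IsBaileyPair a q (fun r => (-1) ^ r * q ^ r.choose 2 * wellPoised a q r)
      fun n => if n = 0 then 1 else 0 := by
  intro n
  cases n with
  | zero => simp [wellPoised]
  | succ n =>
    simp only [Nat.add_eq_zero_iff, one_ne_zero, and_false, if_false]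
    -- The sum telescopes: its partial sums have a closed form. The term r = n + 1 is kept apart,
    -- because n - M truncates at M = n + 1; it cancels the partial sum at M = n.
    have partialSum : ∀ M, M ≤ n → (1 - q ^ (n + 1)) * ∑ r ∈ Finset.range (M + 1),
        (-1) ^ r * q ^ r.choose 2 * wellPoised a q r *
          qPoch (a * q ^ (2 * r + (n + 1 - r) + 1)) q (n + 1 - r) * qPochInv q (n + 1 - r) =
        (-1) ^ M * q ^ (M + 1).choose 2 * qPoch (a * q) q M *
          qPoch (a * q ^ (n + M + 2)) q (n + 1 - M) * qPochInv q M * qPochInv q (n - M) := by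
      intro M
      induction M with
      | zero =>
        intro _
        simp only [zero_add, Finset.range_one, Finset.sum_singleton, wellPoised, Nat.sub_zero]
        rw [qPochInv_eq hq n]
        simp
        ring_nf
      | succ M ih =>
        intro hM
        rw [Finset.sum_range_succ, mul_add, ih (by omega)]
        obtain ⟨t, rfl⟩ := Nat.exists_eq_add_of_le hM
        rw [show M + 1 + t + 1 - (M + 1) = t + 1 by omega, show M + 1 + t - (M + 1) = t by omega,
          show M + 1 + t - M = t + 1 by omega, show M + 1 + t + 1 - M = t + 1 + 1 by omega,
          show M + 1 + t + M + 2 = 2 * M + t + 3 by omega,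
          show M + 1 + t + (M + 1) + 2 = 2 * M + t + 4 by omega,
          show 2 * (M + 1) + (t + 1) + 1 = 2 * M + t + 4 by omega,
          qPoch_succ' (a * q ^ (2 * M + t + 3)),
          show a * q ^ (2 * M + t + 3) * q = a * q ^ (2 * M + t + 4) by ring,
          wellPoised, qPochInv_eq hq M, qPochInv_eq hq t, qPoch_succ (a * q),
          Nat.choose_succ_succ' (M + 1) 1, Nat.choose_one_right]
        ring
    have last := partialSum n le_rfl
    apply (hq n).mul_left_cancel
    rw [mul_zero, Finset.Nat.sum_antidiagonal_eq_sum_range_succ_mk, Finset.sum_range_succ, mul_add,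
      last]
    simp only [Nat.sub_self, qPochInv_zero, qPoch_zero, wellPoised, Nat.add_sub_cancel_left]
    rw [qPochInv_eq hq n, qPoch_succ', qPoch_zero]
    ring

end Finite

/-! ### Iterating the change of base, and the finite identity. -/

section Multisum

open Finset.HasAntidiagonal (antidiagonal mem_antidiagonal)

variable {R : Type*} [CommRing R]

/-- `q^(-n) β_n` for the Bailey pair relative to `(a, q)` that arises from the unit Bailey pair
relative to `(a^(2^k), q^(2^k))` by `k` changes of base. -/
noncomputable def iteratedBeta : ℕ → R → R → ℕ → R
  | 0, _, _, n => if n = 0 then 1 else 0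
  | k + 1, a, q, n => ∑ x ∈ antidiagonal n, qPochInv (q ^ 2) x.1 *
      (qPoch (-(a * q)) q (2 * x.2) * q ^ x.2 * iteratedBeta k (a ^ 2) (q ^ 2) x.2)

/-- In the induction, (a²q²; q²)_{2m} = (aq; q)_{2m} (-aq; q)_{2m}. The first factor merges into
(aq; q)_{2n}; the second is the numerator of the multisum. -/
lemma isBaileyPair_iteratedBeta {q : R} (hq : ∀ n : ℕ, IsUnit (1 - q ^ (n + 1))) (k : ℕ) (a : R) :
    IsBaileyPair a q
      (fun r => (-1) ^ r * (q ^ 2 ^ k) ^ r.choose 2 * wellPoised (a ^ 2 ^ k) (q ^ 2 ^ k) r)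
      fun n => qPoch (a * q) q (2 * n) * (q ^ n * iteratedBeta k a q n) := by
  induction k generalizing a q with
  | zero =>
    have h := isBaileyPair_unit hq a
    intro n
    have hn := h n
    simp only [pow_zero, pow_one]
    rw [← hn]
    cases n <;> simp [iteratedBeta]
  | succ k ih =>
    have h := (ih (isUnit_one_sub_sq hq) (a ^ 2)).changeOfBase hq
    have e : ∀ x : R, (x ^ 2) ^ 2 ^ k = x ^ 2 ^ (k + 1) := fun x => by rw [← pow_mul, ← pow_succ']
    simp only [e] at h
    intro n
    have hn := h n
    simp only at hn ⊢
    rw [← hn, iteratedBeta, Finset.mul_sum, Finset.mul_sum]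
    refine Finset.sum_congr rfl fun x hx => ?_
    rw [← mem_antidiagonal.1 hx, show 2 * (x.1 + x.2) = 2 * x.2 + 2 * x.1 by ring, qPoch_add,
      show a ^ 2 * q ^ 2 = (a * q) ^ 2 by ring, ← qPoch_mul_qPoch_neg,
      show a * q * q ^ (2 * x.2) = a * q ^ (2 * x.2 + 1) by ring]
    ring

lemma qPochRecip_of_add {q : R} {m n i : ℕ} (h : i + n = m) :
    qPochRecip q m n = qPochInv q i := by
  rw [qPochRecip, if_pos (by omega), show m - n = i by omega, qPochInv]

lemma qPochRecip_of_lt {q : R} {m n : ℕ} (h : m < n) : qPochRecip q m n = 0 :=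
  if_neg (by omega)

/-- The convention 1/(q; q)_{negative} = 0 frees the range from n, so that nested sums become one
sum over a box. -/
lemma sum_antidiagonal_eq_sum_range {q : R} (f : ℕ → R) {n N : ℕ} (h : n ≤ N) :
    ∑ x ∈ antidiagonal n, qPochInv q x.1 * f x.2 =
      ∑ m ∈ Finset.range (N + 1), qPochRecip q n m * f m := by
  rw [← Finset.Nat.sum_antidiagonal_swap, Finset.Nat.sum_antidiagonal_eq_sum_range_succ_mk]
  refine Eq.trans ?_ (Finset.sum_subset (Finset.range_mono (show n + 1 ≤ N + 1 by omega)) ?_)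
  · refine Finset.sum_congr rfl fun m hm => ?_
    rw [Finset.mem_range] at hm
    rw [qPochRecip_of_add (show (n - m) + m = n by omega)]
    rfl
  · intro m _ hm
    rw [Finset.mem_range] at hm
    rw [qPochRecip_of_lt (by omega), zero_mul]

lemma sum_piFinset_succ {M : Type*} [AddCommMonoid M] {k : ℕ} (S : Finset ℕ)
    (f : (Fin (k + 1) → ℕ) → M) :
    ∑ s ∈ Fintype.piFinset (fun _ : Fin (k + 1) => S), f s =
      ∑ m ∈ S, ∑ t ∈ Fintype.piFinset (fun _ : Fin k => S), f (Fin.cons m t) := by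
  rw [← Finset.sum_product']
  refine Finset.sum_nbij' (fun s => (s 0, Fin.tail s)) (fun x => Fin.cons x.1 x.2) ?_ ?_ ?_ ?_ ?_
  · intro s hs
    rw [Fintype.mem_piFinset] at hs
    simp only [Finset.mem_product, Fintype.mem_piFinset]
    exact ⟨hs 0, fun i => hs i.succ⟩
  · rintro ⟨m, t⟩ h
    simp only [Finset.mem_product, Fintype.mem_piFinset] at h ⊢
    exact Fin.cases (by simpa using h.1) (fun i => by simpa using h.2 i)
  · intro s _
    simp
  · intro x _
    simp
  · intro s _
    simp

/-- The entries of a tuple, continued by `0`. -/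
def extendZero {k : ℕ} (s : Fin k → ℕ) (i : ℕ) : ℕ := if h : i < k then s ⟨i, h⟩ else 0

lemma idx_succ {k : ℕ} (s : Fin (k + 1) → ℕ) (i : ℕ) : idx s (i + 1) = extendZero s i := by
  unfold idx extendZero
  by_cases h : i < k + 1
  · rw [dif_pos ⟨by omega, by omega⟩, dif_pos h]
    rfl
  · rw [dif_neg (by omega), dif_neg h]

@[simp] lemma extendZero_cons_zero {k : ℕ} (m : ℕ) (t : Fin k → ℕ) :
    extendZero (Fin.cons m t : Fin (k + 1) → ℕ) 0 = m := by
  simp [extendZero]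

@[simp] lemma extendZero_cons_succ {k : ℕ} (m : ℕ) (t : Fin k → ℕ) (i : ℕ) :
    extendZero (Fin.cons m t : Fin (k + 1) → ℕ) (i + 1) = extendZero t i := by
  unfold extendZero
  by_cases h : i < k
  · rw [dif_pos (by omega), dif_pos h]
    exact Fin.cons_succ (α := fun _ => ℕ) m t ⟨i, h⟩
  · rw [dif_neg (by omega), dif_neg h]

/-- The part of the summand of the multisum that comes from `k` changes of base. -/
noncomputable def chainWeight (k : ℕ) (a q : R) (u : ℕ → ℕ) : R :=
  ∏ i ∈ Finset.range k, (qPochRecip (q ^ 2 ^ (i + 1)) (u i) (u (i + 1)) *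
    (qPoch (-(a ^ 2 ^ i * q ^ 2 ^ i)) (q ^ 2 ^ i) (2 * u (i + 1)) * (q ^ 2 ^ i) ^ u (i + 1)))

lemma chainWeight_succ (k : ℕ) (a q : R) (u : ℕ → ℕ) :
    chainWeight (k + 1) a q u = qPochRecip (q ^ 2) (u 0) (u 1) *
      (qPoch (-(a * q)) q (2 * u 1) * q ^ u 1) *
        chainWeight k (a ^ 2) (q ^ 2) (fun i => u (i + 1)) := by
  unfold chainWeight
  rw [Finset.prod_range_succ', mul_comm]
  simp only [← pow_mul, ← pow_succ', zero_add, pow_zero, pow_one]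

/-- The weight `φ` is arbitrary so that the induction can absorb the factors linking an index to the
next one. For k = 0 the index read by `φ` is the default 0, in agreement with the unit pair. -/
lemma sum_chainWeight (k : ℕ) (a q : R) (N : ℕ) (φ : ℕ → R) :
    ∑ s ∈ Fintype.piFinset (fun _ : Fin k => Finset.range (N + 1)),
        φ (extendZero s 0) * chainWeight k a q (extendZero s) =
      ∑ m ∈ Finset.range (N + 1), φ m * iteratedBeta k a q m := by
  induction k generalizing a q φ with
  | zero => simp [chainWeight, iteratedBeta, extendZero]
  | succ k ih =>
    rw [sum_piFinset_succ]
    refine Finset.sum_congr rfl fun m hm => ?_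
    rw [Finset.mem_range] at hm
    rw [iteratedBeta, sum_antidiagonal_eq_sum_range (fun j => qPoch (-(a * q)) q (2 * j) * q ^ j *
      iteratedBeta k (a ^ 2) (q ^ 2) j) (show m ≤ N by omega), Finset.mul_sum]
    simp only [← mul_assoc]
    rw [← ih (a ^ 2) (q ^ 2) (fun j => φ m * qPochRecip (q ^ 2) m j *
      qPoch (-(a * q)) q (2 * j) * q ^ j)]
    refine Finset.sum_congr rfl fun t _ => ?_
    rw [chainWeight_succ]
    simp only [extendZero_cons_zero, extendZero_cons_succ,
      show extendZero (Fin.cons m t : Fin (k + 1) → ℕ) 1 = extendZero t 0 from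
        extendZero_cons_succ m t 0]
    ring

lemma multiTerm_eq (k : ℕ) (a q : R) (s : Fin (k + 1) → ℕ) :
    multiTerm k a q s = a ^ extendZero s 0 * q ^ extendZero s 0 ^ 2 *
      (qPochRecip q (extendZero s 0) (extendZero s 1) * a ^ extendZero s 1 *
        q ^ extendZero s 1 ^ 2 * q ^ extendZero s 1) *
      chainWeight k a q (fun i => extendZero s (i + 1)) := by
  have hIcc : ∀ n : ℕ, Finset.Icc 3 (n + 2) = (Finset.range n).map (addRightEmbedding 3) := by
    intro n
    ext i
    simp only [Finset.mem_Icc, Finset.mem_map, Finset.mem_range, addRightEmbedding_apply]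
    constructor
    · intro h
      exact ⟨i - 3, by omega, by omega⟩
    · rintro ⟨j, hj, rfl⟩
      omega
  have hE : ∑ i ∈ Finset.Icc 3 (k + 1), 2 ^ (i - 3) * idx s i =
      ∑ i ∈ Finset.range k, 2 ^ i * extendZero s (i + 2) := by
    -- Since s_{k+2} = 0, the exponent may be summed over the same range as the product.
    have h : ∑ i ∈ Finset.Icc 3 (k + 1), 2 ^ (i - 3) * idx s i =
        ∑ i ∈ Finset.Icc 3 (k + 2), 2 ^ (i - 3) * idx s i := by
      refine Finset.sum_subset (Finset.Icc_subset_Icc_right (by omega)) fun i hi hi' => ?_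
      rw [Finset.mem_Icc] at hi hi'
      rw [idx, dif_neg (by omega), mul_zero]
    rw [h, hIcc, Finset.sum_map]
    refine Finset.sum_congr rfl fun i _ => ?_
    simp only [addRightEmbedding_apply]
    rw [Nat.add_sub_cancel, show i + 3 = i + 2 + 1 by ring, idx_succ]
  have hP : ∏ i ∈ Finset.Icc 3 (k + 2),
      (qPoch (-(a ^ 2 ^ (i - 3) * q ^ 2 ^ (i - 3))) (q ^ 2 ^ (i - 3)) (2 * idx s i) *
        qPochRecip (q ^ 2 ^ (i - 2)) (idx s (i - 1)) (idx s i)) =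
      ∏ i ∈ Finset.range k,
        (qPoch (-(a ^ 2 ^ i * q ^ 2 ^ i)) (q ^ 2 ^ i) (2 * extendZero s (i + 2)) *
          qPochRecip (q ^ 2 ^ (i + 1)) (extendZero s (i + 1)) (extendZero s (i + 2))) := by
    rw [hIcc, Finset.prod_map]
    refine Finset.prod_congr rfl fun i _ => ?_
    simp only [addRightEmbedding_apply]
    rw [Nat.add_sub_cancel, show i + 3 - 2 = i + 1 by omega, show i + 3 - 1 = i + 1 + 1 by omega,
      show i + 3 = i + 2 + 1 by ring, idx_succ, idx_succ]
  rw [multiTerm, hP, multiExponent, hE, chainWeight]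
  have h1 : idx s 1 = extendZero s 0 := idx_succ s 0
  have h2 : idx s 2 = extendZero s 1 := idx_succ s 1
  rw [h1, h2]
  simp only [Finset.prod_mul_distrib, pow_add, ← Finset.prod_pow_eq_pow_sum, pow_mul, add_assoc,
    Nat.reduceAdd]
  ring

/-- With 1 - a^(2^k) cancelled, no singularity is left: at a^(2^k) = 1, (1 - p^(2r)) (p; p)_{r-1} /
(p; p)_r = 1 + p^r with p = q^(2^k). -/
lemma seriesFactor_eq {k : ℕ} {a q : R} (hq : ∀ n : ℕ, IsUnit (1 - (q ^ 2 ^ k) ^ (n + 1)))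
    (ha : a ^ 2 ^ k = 1 ∨ IsUnit (1 - a ^ 2 ^ k)) (r : ℕ) :
    seriesFactor k a q r = wellPoised (a ^ 2 ^ k) (q ^ 2 ^ k) r := by
  unfold seriesFactor
  split_ifs with h h'
  · rw [h', wellPoised]
  · obtain ⟨r, rfl⟩ := Nat.exists_eq_succ_of_ne_zero h'
    have h1 := qPoch_mul_qPochInv hq r
    rw [Nat.succ_eq_add_one, wellPoised, h, pow_mul]
    simp only [one_mul]
    rw [qPochInv_eq hq r] at h1
    linear_combination -(1 + (q ^ 2 ^ k) ^ (r + 1)) * h1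
  · have ha := ha.resolve_left h
    have key : (1 - a ^ 2 ^ k) * wellPoised (a ^ 2 ^ k) (q ^ 2 ^ k) r =
        (1 - a ^ 2 ^ k * q ^ (r * 2 ^ (k + 1))) * qPoch (a ^ 2 ^ k) (q ^ 2 ^ k) r *
          qPochInv (q ^ 2 ^ k) r := by
      cases r with
      | zero => simp [wellPoised]
      | succ r =>
        rw [wellPoised, qPoch_succ', ← pow_mul, show 2 ^ k * (2 * (r + 1)) =
          (r + 1) * 2 ^ (k + 1) by ring]
        ring
    apply ha.mul_left_cancel
    rw [key, Ring.mul_inverse_rev, qPochInv]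
    have := Ring.mul_inverse_cancel _ ha
    linear_combination ((1 - a ^ 2 ^ k * q ^ (r * 2 ^ (k + 1))) * qPoch (a ^ 2 ^ k) (q ^ 2 ^ k) r *
      Ring.inverse (qPoch (q ^ 2 ^ k) (q ^ 2 ^ k) r)) * this

lemma isUnit_one_sub_pow_pow {q : R} (hq : ∀ n : ℕ, IsUnit (1 - q ^ (n + 1))) {m : ℕ} (hm : 0 < m)
    (n : ℕ) : IsUnit (1 - (q ^ m) ^ (n + 1)) := by
  obtain ⟨j, hj⟩ := Nat.exists_eq_succ_of_ne_zero (Nat.mul_pos hm n.succ_pos).ne'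
  rw [← pow_mul]
  exact hj ▸ hq j

lemma seriesTerm_eq {k : ℕ} {a q : R} (hq : ∀ n : ℕ, IsUnit (1 - q ^ (n + 1)))
    (ha : a ^ 2 ^ k = 1 ∨ IsUnit (1 - a ^ 2 ^ k)) (r : ℕ) :
    seriesTerm k a q r = a ^ r * q ^ r ^ 2 * (a ^ r * q ^ r ^ 2 *
      ((-1) ^ r * (q ^ 2 ^ k) ^ r.choose 2 * wellPoised (a ^ 2 ^ k) (q ^ 2 ^ k) r)) := by
  rw [seriesTerm, seriesFactor_eq (isUnit_one_sub_pow_pow hq (by positivity)) ha, ← pow_mul,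
    pow_add]
  ring

/-- The finite form of the identity. -/
theorem sum_multiTerm_eq_sum_seriesTerm {k : ℕ} {a q : R}
    (hq : ∀ n : ℕ, IsUnit (1 - q ^ (n + 1)))
    (ha : a ^ 2 ^ k = 1 ∨ IsUnit (1 - a ^ 2 ^ k)) (n : ℕ) :
    qPoch (a * q) q (2 * n) *
        ∑ s ∈ Fintype.piFinset (fun _ : Fin (k + 1) => Finset.range (n + 1)),
          multiTerm k a q s * qPochRecip q n (s 0) =
      ∑ r ∈ Finset.range (n + 1), seriesTerm k a q r *
        (qPochRecip q n r * qPoch (a * q ^ (n + r + 1)) q (n - r)) := by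
  have h := ((isBaileyPair_iteratedBeta hq k a).chain hq).chain hq n
  simp only at h
  have hseries : ∑ r ∈ Finset.range (n + 1), seriesTerm k a q r *
        (qPochRecip q n r * qPoch (a * q ^ (n + r + 1)) q (n - r)) =
      ∑ x ∈ antidiagonal n, a ^ x.1 * q ^ x.1 ^ 2 * (a ^ x.1 * q ^ x.1 ^ 2 *
        ((-1) ^ x.1 * (q ^ 2 ^ k) ^ x.1.choose 2 * wellPoised (a ^ 2 ^ k) (q ^ 2 ^ k) x.1)) *
        qPoch (a * q ^ (2 * x.1 + x.2 + 1)) q x.2 * qPochInv q x.2 := by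
    rw [Finset.Nat.sum_antidiagonal_eq_sum_range_succ_mk]
    refine Finset.sum_congr rfl fun r hr => ?_
    rw [Finset.mem_range] at hr
    rw [seriesTerm_eq hq ha, qPochRecip_of_add (show (n - r) + r = n by omega)]
    simp only
    rw [show 2 * r + (n - r) + 1 = n + r + 1 by omega]
    ring
  rw [hseries, ← h, sum_piFinset_succ]
  -- The shifted factorials of the two chain steps and of the initial pair join end to end into (aq;
  -- q)_{2n}.
  have hx : ∀ (f : ℕ → R), ∀ x ∈ antidiagonal n,
      qPoch (a * q ^ (2 * x.2 + 1)) q (2 * x.1) * qPochInv q x.1 * (a ^ x.2 * q ^ x.2 ^ 2 *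
        ∑ y ∈ antidiagonal x.2, qPoch (a * q ^ (2 * y.2 + 1)) q (2 * y.1) * qPochInv q y.1 *
          (a ^ y.2 * q ^ y.2 ^ 2 * (qPoch (a * q) q (2 * y.2) * (q ^ y.2 * f y.2)))) =
      qPoch (a * q) q (2 * n) * (qPochInv q x.1 * (a ^ x.2 * q ^ x.2 ^ 2 *
        ∑ y ∈ antidiagonal x.2, qPochInv q y.1 * (a ^ y.2 * q ^ y.2 ^ 2 * (q ^ y.2 * f y.2)))) := by
    intro f x hx
    have hy : ∑ y ∈ antidiagonal x.2, qPoch (a * q ^ (2 * y.2 + 1)) q (2 * y.1) * qPochInv q y.1 *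
          (a ^ y.2 * q ^ y.2 ^ 2 * (qPoch (a * q) q (2 * y.2) * (q ^ y.2 * f y.2))) =
        qPoch (a * q) q (2 * x.2) * ∑ y ∈ antidiagonal x.2,
          qPochInv q y.1 * (a ^ y.2 * q ^ y.2 ^ 2 * (q ^ y.2 * f y.2)) := by
      rw [Finset.mul_sum]
      refine Finset.sum_congr rfl fun y hy => ?_
      rw [← mem_antidiagonal.1 hy, show 2 * (y.1 + y.2) = 2 * y.2 + 2 * y.1 by ring, qPoch_add,
        show a * q * q ^ (2 * y.2) = a * q ^ (2 * y.2 + 1) by ring]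
      ring
    rw [hy, ← mem_antidiagonal.1 hx, show 2 * (x.1 + x.2) = 2 * x.2 + 2 * x.1 by ring, qPoch_add,
      show a * q * q ^ (2 * x.2) = a * q ^ (2 * x.2 + 1) by ring]
    ring
  rw [Finset.sum_congr rfl (hx _), ← Finset.mul_sum]
  congr 1
  rw [sum_antidiagonal_eq_sum_range (fun m => a ^ m * q ^ m ^ 2 *
    ∑ y ∈ antidiagonal m, qPochInv q y.1 * (a ^ y.2 * q ^ y.2 ^ 2 *
      (q ^ y.2 * iteratedBeta k a q y.2))) le_rfl]
  refine Finset.sum_congr rfl fun m hm => ?_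
  rw [Finset.mem_range] at hm
  rw [sum_antidiagonal_eq_sum_range (fun j => a ^ j * q ^ j ^ 2 * (q ^ j * iteratedBeta k a q j))
    (show m ≤ n by omega)]
  have hw := sum_chainWeight k a q n (fun j => qPochRecip q m j * a ^ j * q ^ j ^ 2 * q ^ j)
  have hw' : ∑ j ∈ Finset.range (n + 1), qPochRecip q m j *
      (a ^ j * q ^ j ^ 2 * (q ^ j * iteratedBeta k a q j)) =
      ∑ j ∈ Finset.range (n + 1), qPochRecip q m j * a ^ j * q ^ j ^ 2 * q ^ j *
        iteratedBeta k a q j := Finset.sum_congr rfl fun j _ => by ring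
  rw [hw', ← hw, Finset.mul_sum, Finset.mul_sum]
  refine Finset.sum_congr rfl fun t _ => ?_
  rw [multiTerm_eq]
  simp only [extendZero_cons_zero, extendZero_cons_succ, Fin.cons_zero,
    show extendZero (Fin.cons m t : Fin (k + 1) → ℕ) 1 = extendZero t 0 from
      extendZero_cons_succ m t 0]
  ring

end Multisum

/-! ### Vanishing of multisum terms outside s_1 ≥ s_2 ≥ ⋯. -/

section Support

variable {R : Type*} [CommRing R]

lemma le_of_qPochRecip_ne_zero {q : R} {m n : ℕ} (h : qPochRecip q m n ≠ 0) : n ≤ m := by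
  by_contra hlt
  exact h (qPochRecip_of_lt (by omega))

/-- The summation indices of a nonzero term of the multisum decrease. -/
lemma extendZero_le_of_multiTerm_ne_zero {k : ℕ} {a q : R} {s : Fin (k + 1) → ℕ}
    (h : multiTerm k a q s ≠ 0) (i : ℕ) : extendZero s i ≤ s 0 := by
  rw [multiTerm_eq] at h
  induction i with
  | zero => simp [extendZero]
  | succ i ih =>
    refine le_trans ?_ ih
    cases i with
    | zero => exact le_of_qPochRecip_ne_zero (q := q) fun h0 => h (by
        rw [zero_add] at h0
        rw [h0]
        ring)
    | succ i =>
      by_cases hi : i < k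
      · refine le_of_qPochRecip_ne_zero (q := q ^ 2 ^ (i + 1)) fun h0 => h ?_
        rw [mul_eq_zero_of_right]
        exact Finset.prod_eq_zero (Finset.mem_range.2 hi) (by rw [h0, zero_mul])
      · rw [extendZero, dif_neg (by omega)]
        exact Nat.zero_le _

lemma le_of_multiTerm_ne_zero {k : ℕ} {a q : R} {s : Fin (k + 1) → ℕ}
    (h : multiTerm k a q s ≠ 0) (i : Fin (k + 1)) : s i ≤ s 0 := by
  have := extendZero_le_of_multiTerm_ne_zero h i
  rwa [extendZero, dif_pos i.2] at this

/-- Outside the box, either the indices are not bounded by s_1 or s_1 > n. Hence the box in the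
finite identity omits nothing. -/
lemma multiTerm_mul_qPochRecip_eq_zero {k : ℕ} {a q : R} {n : ℕ} {s : Fin (k + 1) → ℕ}
    (hs : s ∉ Fintype.piFinset (fun _ : Fin (k + 1) => Finset.range (n + 1))) (y : R) :
    multiTerm k a q s * (y * qPochRecip q n (s 0)) = 0 := by
  by_cases h : multiTerm k a q s = 0
  · rw [h, zero_mul]
  · rw [qPochRecip_of_lt, mul_zero, mul_zero]
    by_contra hn
    refine hs (Fintype.mem_piFinset.2 fun i => Finset.mem_range.2 ?_)
    have := le_of_multiTerm_ne_zero h i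
    omega

end Support

/-! ### The limit in the ring of formal power series. -/

section Formal

variable {K : Type*} [Field K]

lemma dvd_qPoch_sub_one {R : Type*} [CommRing R] {x y : R} (h : y ∣ x) (p : R) (n : ℕ) :
    y ∣ qPoch x p n - 1 := by
  induction n with
  | zero => simp
  | succ n ih =>
    rw [qPoch_succ, show qPoch x p n * (1 - x * p ^ n) - 1 =
      (qPoch x p n - 1) - x * (qPoch x p n * p ^ n) by ring]
    exact dvd_sub ih (h.mul_right _)

lemma PowerSeries.eq_of_forall_X_pow_dvd_sub {f g : K⟦X⟧}
    (h : ∀ M : ℕ, PowerSeries.X ^ M ∣ f - g) : f = g := by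
  ext d
  have := PowerSeries.X_pow_dvd_iff.1 (h (d + 1)) d (Nat.lt_succ_self d)
  rwa [map_sub, sub_eq_zero] at this

lemma PowerSeries.isUnit_one_sub_X_pow (n : ℕ) :
    IsUnit (1 - (PowerSeries.X : K⟦X⟧) ^ (n + 1)) := by
  rw [PowerSeries.isUnit_iff_constantCoeff]
  simp

/-- For n ≥ r the product is (q^(n-r+1); q)_r, which is 1 modulo q^M once n - r ≥ M. -/
lemma X_pow_dvd_qPoch_mul_qPochRecip_sub_one (r M : ℕ) : ∀ᶠ n in Filter.atTop,
    (PowerSeries.X : K⟦X⟧) ^ M ∣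
      qPoch PowerSeries.X PowerSeries.X n * qPochRecip PowerSeries.X n r - 1 := by
  filter_upwards [Filter.eventually_ge_atTop (r + M)] with n hn
  obtain ⟨j, rfl⟩ := Nat.exists_eq_add_of_le hn
  have h := qPoch_mul_qPochInv (PowerSeries.isUnit_one_sub_X_pow (K := K)) (j + M)
  rw [qPochRecip_of_add (show (j + M) + r = r + M + j by ring),
    show r + M + j = (j + M) + r by ring, qPoch_add, mul_right_comm, h, one_mul]
  exact dvd_qPoch_sub_one (Dvd.intro_left (PowerSeries.X * PowerSeries.X ^ j) (by ring)) _ _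

variable [TopologicalSpace K] [DiscreteTopology K]

/-- A family of power series that tends to `0` is summable, and its sum is compatible with
multipliers that tend to `1`. -/
lemma PowerSeries.exists_hasSum_of_X_pow_dvd {ι : Type*} {x : ι → K⟦X⟧}
    (hx : ∀ M : ℕ, {i | ¬ PowerSeries.X ^ M ∣ x i}.Finite) :
    ∃ S : K⟦X⟧, HasSum x S ∧ ∀ (c : ℕ → ι → K⟦X⟧) (F : ℕ → Finset ι),
      (∀ i M, ∀ᶠ n in Filter.atTop, PowerSeries.X ^ M ∣ c n i - 1) →
      (∀ n i, i ∉ F n → x i * c n i = 0) →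
      ∀ M, ∀ᶠ n in Filter.atTop, PowerSeries.X ^ M ∣ ∑ i ∈ F n, x i * c n i - S := by
  classical
  have hcoeff : ∀ (M d : ℕ), d < M → HasSum (fun i => PowerSeries.coeff d (x i))
      (∑ i ∈ (hx M).toFinset, PowerSeries.coeff d (x i)) := by
    intro M d hd
    refine hasSum_sum_of_ne_finset_zero fun i hi => ?_
    rw [Set.Finite.mem_toFinset, Set.mem_ofPred_eq, not_not] at hi
    exact PowerSeries.X_pow_dvd_iff.1 hi d hd
  -- Only the finitely many terms not divisible by X^(d+1) can contribute to coefficient d.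
  refine ⟨PowerSeries.mk fun d => ∑ i ∈ (hx (d + 1)).toFinset, PowerSeries.coeff d (x i), ?_, ?_⟩
  · rw [PowerSeries.WithPiTopology.hasSum_iff_hasSum_coeff]
    intro d
    rw [PowerSeries.coeff_mk]
    exact hcoeff (d + 1) d (Nat.lt_succ_self d)
  · intro c F hc hF M
    have hev : ∀ᶠ n in Filter.atTop, ∀ i ∈ (hx M).toFinset, PowerSeries.X ^ M ∣ c n i - 1 :=
      (Filter.eventually_all_finset _).2 fun i _ => hc i M
    filter_upwards [hev] with n hn
    set T := (hx M).toFinset with hT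
    set S : K⟦X⟧ := PowerSeries.mk fun d =>
      ∑ i ∈ (hx (d + 1)).toFinset, PowerSeries.coeff d (x i) with hS
    have h1 : PowerSeries.X ^ M ∣ ∑ i ∈ T, x i - S := by
      rw [PowerSeries.X_pow_dvd_iff]
      intro d hd
      rw [map_sub, map_sum, hS, PowerSeries.coeff_mk, sub_eq_zero]
      exact (hcoeff M d hd).unique (hcoeff (d + 1) d (Nat.lt_succ_self d))
    have h2 : PowerSeries.X ^ M ∣ ∑ i ∈ T, (x i * c n i - x i) :=
      Finset.dvd_sum fun i hi => by
        rw [show x i * c n i - x i = x i * (c n i - 1) by ring]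
        exact (hn i hi).mul_left _
    have h3 : PowerSeries.X ^ M ∣ ∑ i ∈ (F n ∪ T) \ T, x i * c n i :=
      Finset.dvd_sum fun i hi => by
        have hi := (Finset.mem_sdiff.1 hi).2
        rw [hT, Set.Finite.mem_toFinset, Set.mem_ofPred_eq, not_not] at hi
        exact hi.mul_right _
    have h4 : ∑ i ∈ F n, x i * c n i = ∑ i ∈ F n ∪ T, x i * c n i :=
      Finset.sum_subset Finset.subset_union_left fun i _ hi => hF n i hi
    rw [h4, ← Finset.sum_sdiff (Finset.subset_union_right : T ⊆ F n ∪ T)]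
    rw [Finset.sum_sub_distrib] at h2
    have := dvd_add (dvd_add h3 h2) h1
    convert this using 1
    ring

lemma PowerSeries.exists_hasProd_one_sub (a : K) :
    ∃ P : K⟦X⟧, HasProd (fun n : ℕ => 1 - PowerSeries.C a * PowerSeries.X ^ (n + 1)) P ∧ IsUnit P ∧
      ∀ M, ∀ᶠ n in Filter.atTop,
        PowerSeries.X ^ M ∣ qPoch (PowerSeries.C a * PowerSeries.X) PowerSeries.X n - P := by
  have hmul : Multipliable fun n : ℕ => 1 + -(PowerSeries.C a * PowerSeries.X ^ (n + 1)) := by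
    apply PowerSeries.WithPiTopology.multipliable_one_add_of_tendsto_order_atTop_nhds_top
    rw [ENat.tendsto_nhds_top_iff_natCast_lt]
    intro m
    filter_upwards [Filter.eventually_ge_atTop m] with n hn
    refine lt_of_lt_of_le (b := ((n + 1 : ℕ) : ℕ∞)) (by exact_mod_cast Nat.lt_succ_of_le hn) ?_
    refine PowerSeries.le_order _ _ fun i hi => ?_
    have h : (PowerSeries.X : K⟦X⟧) ^ (n + 1) ∣ -(PowerSeries.C a * PowerSeries.X ^ (n + 1)) :=
      (Dvd.intro_left _ rfl).neg_right
    exact PowerSeries.X_pow_dvd_iff.1 h i (by exact_mod_cast hi)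
  simp only [← sub_eq_add_neg] at hmul
  have hev : ∀ M, ∀ᶠ n in Filter.atTop,
      PowerSeries.X ^ M ∣ qPoch (PowerSeries.C a * PowerSeries.X) PowerSeries.X n -
        ∏' n : ℕ, (1 - PowerSeries.C a * PowerSeries.X ^ (n + 1)) := by
    intro M
    have ht := hmul.hasProd.tendsto_prod_nat
    rw [PowerSeries.WithPiTopology.tendsto_iff_coeff_tendsto] at ht
    have hd : ∀ᶠ n in Filter.atTop, ∀ d ∈ Finset.range M,
        PowerSeries.coeff d (∏ i ∈ Finset.range n, (1 - PowerSeries.C a * PowerSeries.X ^ (i + 1))) =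
        PowerSeries.coeff d (∏' n : ℕ, (1 - PowerSeries.C a * PowerSeries.X ^ (n + 1))) := by
      refine (Filter.eventually_all_finset _).2 fun d _ => ?_
      have := ht d
      rw [nhds_discrete, Filter.tendsto_pure] at this
      exact this
    filter_upwards [hd] with n hn
    rw [PowerSeries.X_pow_dvd_iff]
    intro d hdM
    rw [map_sub, sub_eq_zero, ← hn d (Finset.mem_range.2 hdM), qPoch]
    simp only [pow_succ', mul_assoc]
  refine ⟨_, hmul.hasProd, ?_, hev⟩
  -- Modulo X the infinite product agrees with a partial product, hence with 1.
  obtain ⟨n, hn⟩ := (hev 1).exists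
  have h1 := dvd_qPoch_sub_one (Dvd.intro_left (PowerSeries.C a) rfl :
    (PowerSeries.X : K⟦X⟧) ∣ PowerSeries.C a * PowerSeries.X) PowerSeries.X n
  rw [pow_one] at hn
  have h2 := dvd_sub h1 hn
  rw [PowerSeries.X_dvd_iff, map_sub, map_sub, map_sub, map_one] at h2
  rw [PowerSeries.isUnit_iff_constantCoeff, show PowerSeries.constantCoeff
    (∏' n : ℕ, (1 - PowerSeries.C a * PowerSeries.X ^ (n + 1))) = 1 by linear_combination h2]
  exact isUnit_one

theorem hasSum_multiTerm_powerSeries (k : ℕ) (a : K) :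
    ∃ P S : K⟦X⟧,
        HasProd (fun n : ℕ => 1 - PowerSeries.C a * PowerSeries.X ^ (n + 1)) P ∧ IsUnit P ∧
        HasSum (fun r : ℕ => seriesTerm k (PowerSeries.C a) PowerSeries.X r) S ∧
        HasSum (fun s : Fin (k + 1) → ℕ => multiTerm k (PowerSeries.C a) PowerSeries.X s)
          (Ring.inverse P * S) := by
  have hq := PowerSeries.isUnit_one_sub_X_pow (K := K)
  have ha : (PowerSeries.C a : K⟦X⟧) ^ 2 ^ k = 1 ∨ IsUnit (1 - (PowerSeries.C a : K⟦X⟧) ^ 2 ^ k) := by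
    by_cases h : a ^ 2 ^ k = 1
    · left
      rw [← map_pow, h, map_one]
    · right
      rw [PowerSeries.isUnit_iff_constantCoeff, map_sub, map_pow, map_one,
        PowerSeries.constantCoeff_C]
      exact (sub_ne_zero.2 (Ne.symm h)).isUnit
  obtain ⟨P, hP, hPu, hPlim⟩ := PowerSeries.exists_hasProd_one_sub a
  obtain ⟨S, hS, hSlim⟩ := PowerSeries.exists_hasSum_of_X_pow_dvd
    (x := fun r : ℕ => seriesTerm k (PowerSeries.C a) PowerSeries.X r) (fun M => by
      refine (Finset.finite_toSet (Finset.range M)).subset fun r hr => ?_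
      rw [Finset.mem_coe, Finset.mem_range]
      by_contra hle
      refine hr ?_
      rw [seriesTerm_eq hq ha]
      refine Dvd.dvd.mul_right (Dvd.dvd.mul_left (pow_dvd_pow _ ?_) _) _
      nlinarith)
  obtain ⟨U, hU, hUlim⟩ := PowerSeries.exists_hasSum_of_X_pow_dvd
    (x := fun s : Fin (k + 1) → ℕ => multiTerm k (PowerSeries.C a) PowerSeries.X s) (fun M => by
      refine (Finset.finite_toSet
        (Fintype.piFinset fun _ : Fin (k + 1) => Finset.range M)).subset fun s hs => ?_
      have hs0 : multiTerm k (PowerSeries.C a) PowerSeries.X s ≠ 0 :=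
        fun h => hs (by rw [h]; exact dvd_zero _)
      -- The factor q^(s_1²) bounds s_1, and s_1 bounds the other indices of a nonzero term.
      have hM : s 0 < M := by
        by_contra hle
        refine hs ?_
        rw [multiTerm_eq]
        refine Dvd.dvd.mul_right (Dvd.dvd.mul_right (Dvd.dvd.mul_left (pow_dvd_pow _ ?_) _) _) _
        have : extendZero s 0 = s 0 := by simp [extendZero]
        rw [this]
        nlinarith
      rw [Finset.mem_coe, Fintype.mem_piFinset]
      exact fun i => Finset.mem_range.2 ((le_of_multiTerm_ne_zero hs0 i).trans_lt hM))
  refine ⟨P, S, hP, hPu, hS, ?_⟩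
  -- Modulo X^M, a single large n suffices: there the finite identity times (q; q)_n agrees with P U
  -- = S.
  have key : P * U = S := by
    refine PowerSeries.eq_of_forall_X_pow_dvd_sub fun M => ?_
    have h1 := hUlim
      (fun n s => qPoch PowerSeries.X PowerSeries.X n * qPochRecip PowerSeries.X n (s 0))
      (fun n => Fintype.piFinset fun _ => Finset.range (n + 1))
      (fun s M => X_pow_dvd_qPoch_mul_qPochRecip_sub_one (K := K) (s 0) M)
      (fun n s hs => multiTerm_mul_qPochRecip_eq_zero hs _) M
    have h2 := hSlim (fun n r => qPoch PowerSeries.X PowerSeries.X n * qPochRecip PowerSeries.X n r *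
        qPoch (PowerSeries.C a * PowerSeries.X ^ (n + r + 1)) PowerSeries.X (n - r))
      (fun n => Finset.range (n + 1))
      (fun r M => by
        filter_upwards [X_pow_dvd_qPoch_mul_qPochRecip_sub_one (K := K) r M,
          Filter.eventually_ge_atTop M] with n h1 hn
        have h2 := dvd_qPoch_sub_one (x := PowerSeries.C a * (PowerSeries.X : K⟦X⟧) ^ (n + r + 1))
          (((pow_dvd_pow PowerSeries.X (show M ≤ n + r + 1 by omega))).mul_left _)
          PowerSeries.X (n - r)
        have h3 := dvd_add (h1.mul_right
          (qPoch (PowerSeries.C a * PowerSeries.X ^ (n + r + 1)) PowerSeries.X (n - r))) h2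
        convert h3 using 1
        ring)
      (fun n r hr => by
        rw [Finset.mem_range] at hr
        rw [qPochRecip_of_lt (by omega)]
        ring) M
    have h3 : ∀ᶠ n in Filter.atTop, PowerSeries.X ^ M ∣
        qPoch (PowerSeries.C a * PowerSeries.X) PowerSeries.X (2 * n) - P := by
      obtain ⟨N, hN⟩ := Filter.eventually_atTop.1 (hPlim M)
      exact Filter.eventually_atTop.2 ⟨N, fun n hn => hN _ (by omega)⟩
    obtain ⟨n, h1, h2, h3⟩ := (h1.and (h2.and h3)).exists
    have hfin := sum_multiTerm_eq_sum_seriesTerm hq ha n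
    have e1 : ∑ s ∈ Fintype.piFinset (fun _ : Fin (k + 1) => Finset.range (n + 1)),
        multiTerm k (PowerSeries.C a) PowerSeries.X s *
          (qPoch PowerSeries.X PowerSeries.X n * qPochRecip PowerSeries.X n (s 0)) =
        qPoch PowerSeries.X PowerSeries.X n *
          ∑ s ∈ Fintype.piFinset (fun _ : Fin (k + 1) => Finset.range (n + 1)),
            multiTerm k (PowerSeries.C a) PowerSeries.X s * qPochRecip PowerSeries.X n (s 0) := by
      rw [Finset.mul_sum]
      exact Finset.sum_congr rfl fun s _ => by ring
    have e2 : ∑ r ∈ Finset.range (n + 1), seriesTerm k (PowerSeries.C a) PowerSeries.X r *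
          (qPoch PowerSeries.X PowerSeries.X n * qPochRecip PowerSeries.X n r *
            qPoch (PowerSeries.C a * PowerSeries.X ^ (n + r + 1)) PowerSeries.X (n - r)) =
        qPoch PowerSeries.X PowerSeries.X n *
          ∑ r ∈ Finset.range (n + 1), seriesTerm k (PowerSeries.C a) PowerSeries.X r *
            (qPochRecip PowerSeries.X n r *
              qPoch (PowerSeries.C a * PowerSeries.X ^ (n + r + 1)) PowerSeries.X (n - r)) := by
      rw [Finset.mul_sum]
      exact Finset.sum_congr rfl fun s _ => by ring
    rw [e1] at h1
    rw [e2, ← hfin] at h2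
    have h4 := dvd_sub h2 (dvd_add (h1.mul_left (qPoch (PowerSeries.C a * PowerSeries.X)
      PowerSeries.X (2 * n))) (h3.mul_right U))
    convert h4 using 1
    ring
  rw [← key, ← mul_assoc, Ring.inverse_mul_cancel _ hPu, one_mul]
  exact hU

end Formal

/-! ### Absolute convergence and the limit over the complex numbers. -/

section Analytic

open Filter Topology

lemma one_sub_pow_ne_zero {q : ℂ} (hq : ‖q‖ < 1) (n : ℕ) : 1 - q ^ (n + 1) ≠ 0 := by
  intro h
  have h1 : ‖q ^ (n + 1)‖ < 1 := by
    rw [norm_pow]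
    exact pow_lt_one₀ (norm_nonneg _) hq (Nat.succ_ne_zero n)
  rw [← sub_eq_zero.1 h, norm_one] at h1
  exact lt_irrefl _ h1

lemma norm_pow_two_pow_lt_one {q : ℂ} (hq : ‖q‖ < 1) (i : ℕ) : ‖q ^ 2 ^ i‖ < 1 := by
  rw [norm_pow]
  exact pow_lt_one₀ (norm_nonneg _) hq (by positivity)

lemma summable_norm_neg_mul_pow (x : ℂ) {p : ℂ} (hp : ‖p‖ < 1) :
    Summable fun n : ℕ => ‖-(x * p ^ n)‖ := by
  simp only [norm_neg, norm_mul, norm_pow]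
  exact (summable_geometric_of_lt_one (norm_nonneg _) hp).mul_left _

lemma hasProd_one_sub_mul_pow (x : ℂ) {p : ℂ} (hp : ‖p‖ < 1) :
    HasProd (fun n : ℕ => 1 - x * p ^ n) (∏' n : ℕ, (1 - x * p ^ n)) := by
  have h := multipliable_one_add_of_summable (summable_norm_neg_mul_pow x hp)
  simp only [← sub_eq_add_neg] at h
  exact h.hasProd

lemma tendsto_qPoch (x : ℂ) {p : ℂ} (hp : ‖p‖ < 1) :
    Tendsto (fun n => qPoch x p n) atTop (𝓝 (∏' n : ℕ, (1 - x * p ^ n))) :=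
  (hasProd_one_sub_mul_pow x hp).tendsto_prod_nat

lemma tprod_one_sub_mul_pow_ne_zero {x p : ℂ} (hp : ‖p‖ < 1) (h : ∀ n : ℕ, 1 - x * p ^ n ≠ 0) :
    ∏' n : ℕ, (1 - x * p ^ n) ≠ 0 := by
  have := tprod_one_add_ne_zero_of_summable (f := fun n : ℕ => -(x * p ^ n))
    (fun n => by rw [← sub_eq_add_neg]; exact h n) (summable_norm_neg_mul_pow x hp)
  simpa only [← sub_eq_add_neg] using this

lemma exists_norm_le_of_tendsto {u : ℕ → ℂ} {l : ℂ} (h : Tendsto u atTop (𝓝 l)) :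
    ∃ C, 0 ≤ C ∧ ∀ n, ‖u n‖ ≤ C := by
  obtain ⟨C, hC⟩ := h.norm.bddAbove_range
  exact ⟨C, (norm_nonneg _).trans (hC ⟨0, rfl⟩), fun n => hC ⟨n, rfl⟩⟩

lemma exists_norm_qPoch_le (x : ℂ) {p : ℂ} (hp : ‖p‖ < 1) : ∃ C, 0 ≤ C ∧ ∀ n, ‖qPoch x p n‖ ≤ C :=
  exists_norm_le_of_tendsto (tendsto_qPoch x hp)

lemma tprod_self_ne_zero {q : ℂ} (hq : ‖q‖ < 1) : ∏' n : ℕ, (1 - q * q ^ n) ≠ 0 :=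
  tprod_one_sub_mul_pow_ne_zero hq fun n => by
    rw [← pow_succ']
    exact one_sub_pow_ne_zero hq n

lemma tendsto_qPochInv {q : ℂ} (hq : ‖q‖ < 1) :
    Tendsto (fun n => qPochInv q n) atTop (𝓝 (∏' n : ℕ, (1 - q * q ^ n))⁻¹) := by
  simp only [qPochInv, Ring.inverse_eq_inv']
  exact (tendsto_qPoch q hq).inv₀ (tprod_self_ne_zero hq)

lemma exists_norm_qPochInv_le {q : ℂ} (hq : ‖q‖ < 1) : ∃ C, 0 ≤ C ∧ ∀ n, ‖qPochInv q n‖ ≤ C :=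
  exists_norm_le_of_tendsto (tendsto_qPochInv hq)

lemma exists_norm_qPochRecip_le {q : ℂ} (hq : ‖q‖ < 1) :
    ∃ C, 0 ≤ C ∧ ∀ m n, ‖qPochRecip q m n‖ ≤ C := by
  obtain ⟨C, hC0, hC⟩ := exists_norm_qPochInv_le hq
  refine ⟨C, hC0, fun m n => ?_⟩
  unfold qPochRecip
  split_ifs
  · exact hC _
  · rwa [norm_zero]

lemma tendsto_qPoch_mul_qPochRecip {q : ℂ} (hq : ‖q‖ < 1) (r : ℕ) :
    Tendsto (fun n => qPoch q q n * qPochRecip q n r) atTop (𝓝 1) := by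
  rw [← mul_inv_cancel₀ (tprod_self_ne_zero hq)]
  refine (tendsto_qPoch q hq).mul ?_
  refine ((tendsto_qPochInv hq).comp (tendsto_sub_atTop_nat r)).congr' ?_
  filter_upwards [eventually_ge_atTop r] with n hn
  exact (qPochRecip_of_add (Nat.sub_add_cancel hn)).symm

/-- x^n ρ^(n²) = (x ρ^n)^n, and x ρ^n ≤ 1 from some N on; the earlier terms are at most max(1, x)^N.
-/
lemma exists_pow_mul_pow_sq_le {x ρ : ℝ} (hx : 0 ≤ x) (hρ0 : 0 ≤ ρ) (hρ : ρ < 1) :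
    ∃ C, 0 ≤ C ∧ ∀ n : ℕ, x ^ n * ρ ^ n ^ 2 ≤ C := by
  have ht : Tendsto (fun n : ℕ => x * ρ ^ n) atTop (𝓝 (x * 0)) :=
    (tendsto_pow_atTop_nhds_zero_of_lt_one hρ0 hρ).const_mul x
  rw [mul_zero] at ht
  obtain ⟨N, hN⟩ := eventually_atTop.1 (ht.eventually_le_const zero_lt_one)
  have h1 : (1 : ℝ) ≤ max 1 x := le_max_left _ _
  refine ⟨max 1 x ^ N, by positivity, fun n => ?_⟩
  by_cases hn : N ≤ n
  · rw [sq, pow_mul, ← mul_pow]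
    exact (pow_le_one₀ (by positivity) (hN n hn)).trans (one_le_pow₀ h1)
  · calc x ^ n * ρ ^ n ^ 2 ≤ x ^ n * 1 := by
          gcongr
          exact pow_le_one₀ hρ0 hρ.le
      _ ≤ max 1 x ^ n := by
          rw [mul_one]
          gcongr
          exact le_max_right _ _
      _ ≤ max 1 x ^ N := pow_le_pow_right₀ h1 (by omega)

/-- The Gaussian factor beats every geometric one. -/
lemma exists_pow_mul_pow_sq_le_geometric {x ρ : ℝ} (hx : 0 ≤ x) (hρ0 : 0 ≤ ρ) (hρ : ρ < 1) (j : ℕ) :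
    ∃ C, 0 ≤ C ∧ ∀ n : ℕ, x ^ n * ρ ^ n ^ 2 ≤ C * ((1 / 2) ^ n) ^ j := by
  obtain ⟨C, hC0, hC⟩ := exists_pow_mul_pow_sq_le (x := x * 2 ^ j) (by positivity) hρ0 hρ
  refine ⟨C, hC0, fun n => ?_⟩
  have h : (2 ^ j : ℝ) ^ n * ((1 / 2) ^ n) ^ j = 1 := by
    rw [← pow_mul, ← pow_mul, mul_comm n j, ← mul_pow]
    norm_num
  calc x ^ n * ρ ^ n ^ 2 = (x * 2 ^ j) ^ n * ρ ^ n ^ 2 * ((1 / 2) ^ n) ^ j := by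
        rw [mul_pow]
        linear_combination (-(x ^ n * ρ ^ n ^ 2)) * h
    _ ≤ _ := by
        gcongr
        exact hC n

lemma exists_norm_wellPoised_le (a : ℂ) {q : ℂ} (hq : ‖q‖ < 1) :
    ∃ C, 0 ≤ C ∧ ∀ r, ‖wellPoised a q r‖ ≤ C := by
  obtain ⟨C1, h10, h1⟩ := exists_norm_qPoch_le (a * q) hq
  obtain ⟨C2, h20, h2⟩ := exists_norm_qPochInv_le hq
  refine ⟨max 1 ((1 + ‖a‖) * C1 * C2), le_max_of_le_left zero_le_one, fun r => ?_⟩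
  cases r with
  | zero => simp [wellPoised]
  | succ r =>
    refine le_max_of_le_right ?_
    rw [wellPoised, norm_mul, norm_mul]
    gcongr
    · refine (norm_sub_le _ _).trans ?_
      rw [norm_one, norm_mul, norm_pow]
      gcongr
      exact mul_le_of_le_one_right (norm_nonneg _) (pow_le_one₀ (norm_nonneg _) hq.le)
    · exact h1 r
    · exact h2 _

lemma summable_norm_seriesTerm (k : ℕ) (a : ℂ) {q : ℂ} (hq : ‖q‖ < 1) :
    Summable fun r : ℕ => ‖seriesTerm k a q r‖ := by
  have hu : ∀ n : ℕ, IsUnit (1 - q ^ (n + 1)) := fun n => (one_sub_pow_ne_zero hq n).isUnit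
  have ha : a ^ 2 ^ k = 1 ∨ IsUnit (1 - a ^ 2 ^ k) := by
    by_cases h : a ^ 2 ^ k = 1
    · exact Or.inl h
    · exact Or.inr (sub_ne_zero.2 (Ne.symm h)).isUnit
  obtain ⟨C, hC0, hC⟩ := exists_norm_wellPoised_le (a ^ 2 ^ k) (norm_pow_two_pow_lt_one hq k)
  obtain ⟨D, hD0, hD⟩ := exists_pow_mul_pow_sq_le_geometric (x := ‖a‖ ^ 2) (by positivity)
    (norm_nonneg q) hq 1
  have hs : Summable fun r : ℕ => D * C * (1 / 2 : ℝ) ^ r :=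
    (summable_geometric_of_lt_one (by norm_num) (by norm_num)).mul_left _
  refine hs.of_nonneg_of_le (fun r => norm_nonneg _) fun r => ?_
  rw [seriesTerm_eq hu ha]
  simp only [norm_mul, norm_pow, norm_neg, norm_one, one_pow, one_mul]
  have h1 : ‖q‖ ^ r ^ 2 ≤ 1 := pow_le_one₀ (norm_nonneg _) hq.le
  have h2 : (‖q‖ ^ 2 ^ k) ^ r.choose 2 ≤ 1 :=
    pow_le_one₀ (by positivity) (pow_le_one₀ (norm_nonneg _) hq.le)
  have h3 := hD r
  rw [pow_one] at h3
  calc ‖a‖ ^ r * ‖q‖ ^ r ^ 2 * (‖a‖ ^ r * ‖q‖ ^ r ^ 2 * ((‖q‖ ^ 2 ^ k) ^ r.choose 2 *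
        ‖wellPoised (a ^ 2 ^ k) (q ^ 2 ^ k) r‖))
      ≤ ‖a‖ ^ r * ‖q‖ ^ r ^ 2 * (‖a‖ ^ r * 1 * (1 * C)) := by
        gcongr
        exact hC r
    _ = (‖a‖ ^ 2) ^ r * ‖q‖ ^ r ^ 2 * C := by ring
    _ ≤ D * (1 / 2) ^ r * C := by gcongr
    _ = D * C * (1 / 2) ^ r := by ring

/-- Shifted factorials and their reciprocals converge, hence are bounded, so the Gaussian factor in
s_1 alone has to give summability. -/
lemma exists_norm_chainWeight_le (k : ℕ) (a : ℂ) {q : ℂ} (hq : ‖q‖ < 1) :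
    ∃ C, 0 ≤ C ∧ ∀ u, ‖chainWeight k a q u‖ ≤ C := by
  have h1 := fun i : ℕ => exists_norm_qPochRecip_le (norm_pow_two_pow_lt_one hq (i + 1))
  have h2 := fun i : ℕ => exists_norm_qPoch_le (-(a ^ 2 ^ i * q ^ 2 ^ i))
    (norm_pow_two_pow_lt_one hq i)
  choose C hC0 hC using h1
  choose D hD0 hD using h2
  refine ⟨∏ i ∈ Finset.range k, C i * (D i * 1),
    Finset.prod_nonneg fun i _ => mul_nonneg (hC0 i) (mul_nonneg (hD0 i) zero_le_one),
    fun u => ?_⟩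
  rw [chainWeight, norm_prod]
  refine Finset.prod_le_prod (fun i _ => norm_nonneg _) fun i _ => ?_
  rw [norm_mul, norm_mul]
  refine mul_le_mul (hC i _ _) (mul_le_mul (hD i _) ?_ (norm_nonneg _) (hD0 i))
    (by positivity) (hC0 i)
  rw [norm_pow]
  exact pow_le_one₀ (norm_nonneg _) (norm_pow_two_pow_lt_one hq i).le

lemma summable_prod_geometric (k : ℕ) :
    Summable fun s : Fin k → ℕ => ∏ i, (1 / 2 : ℝ) ^ s i := by
  refine summable_of_sum_le (c := 2 ^ k) (fun s => by positivity) fun u => ?_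
  obtain ⟨N, hN⟩ : ∃ N, ∀ s ∈ u, ∀ i, s i < N := by
    refine ⟨u.sup (fun s => ∑ i, s i) + 1, fun s hs i => Nat.lt_succ_of_le ?_⟩
    exact (Finset.single_le_sum (f := s) (fun _ _ => Nat.zero_le _) (Finset.mem_univ i)).trans
      (Finset.le_sup (f := fun s : Fin k → ℕ => ∑ i, s i) hs)
  calc ∑ s ∈ u, ∏ i, (1 / 2 : ℝ) ^ s i
      ≤ ∑ s ∈ Fintype.piFinset (fun _ : Fin k => Finset.range N), ∏ i, (1 / 2 : ℝ) ^ s i :=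
        Finset.sum_le_sum_of_subset_of_nonneg
          (fun s hs => Fintype.mem_piFinset.2 fun i => Finset.mem_range.2 (hN s hs i))
          (fun s _ _ => by positivity)
    _ = ∏ _i : Fin k, ∑ j ∈ Finset.range N, (1 / 2 : ℝ) ^ j :=
        (Finset.prod_univ_sum (fun _ : Fin k => Finset.range N) (fun _ j => (1 / 2 : ℝ) ^ j)).symm
    _ ≤ ∏ _i : Fin k, 2 := by
        refine Finset.prod_le_prod (fun i _ => by positivity) fun i _ => ?_
        have := Summable.sum_le_tsum (f := fun j : ℕ => (1 / 2 : ℝ) ^ j) (Finset.range N)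
          (fun j _ => by positivity)
          (summable_geometric_of_lt_one (by norm_num) (by norm_num))
        rwa [tsum_geometric_two] at this
    _ = 2 ^ k := by simp

lemma summable_norm_multiTerm (k : ℕ) (a : ℂ) {q : ℂ} (hq : ‖q‖ < 1) :
    Summable fun s : Fin (k + 1) → ℕ => ‖multiTerm k a q s‖ := by
  obtain ⟨C, hC0, hC⟩ := exists_norm_chainWeight_le k a hq
  obtain ⟨B, hB0, hB⟩ := exists_norm_qPochRecip_le hq
  set M : ℝ := max 1 ‖a‖ with hM
  have hM1 : 1 ≤ M := le_max_left _ _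
  -- The square accounts for a^(s_1 + s_2) with s_2 ≤ s_1. The exponent k + 1 provides one factor
  -- 2^(-s_1) ≤ 2^(-s_i) per index.
  obtain ⟨D, hD0, hD⟩ := exists_pow_mul_pow_sq_le_geometric (x := M ^ 2) (by positivity)
    (norm_nonneg q) hq (k + 1)
  refine ((summable_prod_geometric (k + 1)).mul_left (D * B * C)).of_nonneg_of_le
    (fun s => norm_nonneg _) fun s => ?_
  by_cases h : multiTerm k a q s = 0
  · rw [h, norm_zero]
    positivity
  have h0 : extendZero s 0 = s 0 := by simp [extendZero]
  have h1 := extendZero_le_of_multiTerm_ne_zero h 1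
  have hpow : ∀ n : ℕ, ‖a‖ ^ n ≤ M ^ n := fun n => by
    gcongr
    exact le_max_right _ _
  have hq1 : ∀ n : ℕ, ‖q‖ ^ n ≤ 1 := fun n => pow_le_one₀ (norm_nonneg _) hq.le
  have hgeom : ((1 / 2 : ℝ) ^ s 0) ^ (k + 1) ≤ ∏ i, (1 / 2 : ℝ) ^ s i := by
    calc ((1 / 2 : ℝ) ^ s 0) ^ (k + 1) = ∏ _i : Fin (k + 1), (1 / 2 : ℝ) ^ s 0 := by simp
      _ ≤ _ := Finset.prod_le_prod (fun i _ => by positivity) fun i _ =>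
        pow_le_pow_of_le_one (by norm_num) (by norm_num) (le_of_multiTerm_ne_zero h i)
  rw [multiTerm_eq, h0]
  simp only [norm_mul, norm_pow]
  calc ‖a‖ ^ s 0 * ‖q‖ ^ s 0 ^ 2 * (‖qPochRecip q (s 0) (extendZero s 1)‖ * ‖a‖ ^ extendZero s 1 *
        ‖q‖ ^ extendZero s 1 ^ 2 * ‖q‖ ^ extendZero s 1) *
        ‖chainWeight k a q fun i => extendZero s (i + 1)‖
      ≤ M ^ s 0 * ‖q‖ ^ s 0 ^ 2 * (B * M ^ s 0 * 1 * 1) * C := by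
        gcongr ?_ * _ * (?_ * ?_ * ?_ * ?_) * ?_
        · exact hpow _
        · exact hB _ _
        · exact (hpow _).trans (pow_le_pow_right₀ hM1 h1)
        · exact hq1 _
        · exact hq1 _
        · exact hC _
    _ = (M ^ 2) ^ s 0 * ‖q‖ ^ s 0 ^ 2 * B * C := by ring
    _ ≤ D * ((1 / 2) ^ s 0) ^ (k + 1) * B * C := by
        gcongr ?_ * B * C
        exact hD _
    _ ≤ D * (∏ i, (1 / 2) ^ s i) * B * C := by gcongr
    _ = D * B * C * ∏ i, (1 / 2) ^ s i := by ring

/-- Tannery's theorem: the terms outside `F n` vanish, so the finite sums are full series dominated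
by C‖x i‖. -/
lemma tendsto_sum_mul {ι : Type*} {x : ι → ℂ} (hx : Summable fun i => ‖x i‖) {c : ℕ → ι → ℂ} {C : ℝ}
    (hC : ∀ n i, ‖c n i‖ ≤ C) (hc : ∀ i, Tendsto (fun n => c n i) atTop (𝓝 1))
    {F : ℕ → Finset ι} (hF : ∀ n i, i ∉ F n → x i * c n i = 0) :
    Tendsto (fun n => ∑ i ∈ F n, x i * c n i) atTop (𝓝 (∑' i, x i)) := by
  have h := tendsto_tsum_of_dominated_convergence (𝓕 := atTop) (f := fun n i => x i * c n i)
    (g := x) (bound := fun i => ‖x i‖ * C) (hx.mul_right C)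
    (fun i => by simpa using (hc i).const_mul (x i))
    (Eventually.of_forall fun n i => by
      rw [norm_mul]
      exact mul_le_mul_of_nonneg_left (hC n i) (norm_nonneg _))
  exact h.congr fun n => tsum_eq_sum fun i hi => hF n i hi

theorem hasSum_multiTerm_complex (k : ℕ) (a q : ℂ) (hq : ‖q‖ < 1)
    (ha : ∀ n : ℕ, a * q ^ (n + 1) ≠ 1) :
    ∃ P S : ℂ,
        HasProd (fun n : ℕ => 1 - a * q ^ (n + 1)) P ∧ IsUnit P ∧
        HasSum (fun r : ℕ => seriesTerm k a q r) S ∧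
        HasSum (fun s : Fin (k + 1) → ℕ => multiTerm k a q s) (Ring.inverse P * S) := by
  have hu : ∀ n : ℕ, IsUnit (1 - q ^ (n + 1)) := fun n => (one_sub_pow_ne_zero hq n).isUnit
  have ha' : a ^ 2 ^ k = 1 ∨ IsUnit (1 - a ^ 2 ^ k) := by
    by_cases h : a ^ 2 ^ k = 1
    · exact Or.inl h
    · exact Or.inr (sub_ne_zero.2 (Ne.symm h)).isUnit
  have hfac : ∀ n : ℕ, 1 - a * q * q ^ n ≠ 0 := fun n => by
    rw [mul_assoc, ← pow_succ']
    exact sub_ne_zero.2 (ha n).symm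
  have hqP : ∀ n, qPoch (a * q) q n ≠ 0 := fun n => Finset.prod_ne_zero_iff.2 fun i _ => hfac i
  set P : ℂ := ∏' n : ℕ, (1 - a * q * q ^ n) with hP
  have hP0 : P ≠ 0 := tprod_one_sub_mul_pow_ne_zero hq hfac
  have hPlim : Tendsto (fun n => qPoch (a * q) q n) atTop (𝓝 P) := tendsto_qPoch (a * q) hq
  have hProd : HasProd (fun n : ℕ => 1 - a * q ^ (n + 1)) P := by
    convert hasProd_one_sub_mul_pow (a * q) hq using 2 with n
    rw [pow_succ', mul_assoc]
  have hT := summable_norm_multiTerm k a hq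
  have hS := summable_norm_seriesTerm k a hq
  obtain ⟨C1, hC10, hC1⟩ := exists_norm_qPoch_le q hq
  obtain ⟨C2, hC20, hC2⟩ := exists_norm_qPochRecip_le hq
  obtain ⟨C3, hC30, hC3⟩ := exists_norm_le_of_tendsto hPlim
  obtain ⟨C4, hC40, hC4⟩ := exists_norm_le_of_tendsto (hPlim.inv₀ hP0)
  -- As a q^n ≠ 1, this factor is a quotient of partial products with nonzero limit. That gives a
  -- bound uniform in n and r, and the limit 1 for fixed r.
  have hquot : ∀ n r : ℕ, r ≤ n → qPoch (a * q ^ (n + r + 1)) q (n - r) =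
      qPoch (a * q) q (2 * n) * (qPoch (a * q) q (n + r))⁻¹ := fun n r hr => by
    rw [show 2 * n = (n + r) + (n - r) by omega, qPoch_add,
      show a * q * q ^ (n + r) = a * q ^ (n + r + 1) by ring, mul_right_comm,
      mul_inv_cancel₀ (hqP _), one_mul]
  have htwo : Tendsto (fun n => qPoch (a * q) q (2 * n)) atTop (𝓝 P) :=
    hPlim.comp (tendsto_id.const_mul_atTop' two_pos)
  have hlimT := tendsto_sum_mul hT (c := fun n s => qPoch q q n * qPochRecip q n (s 0))
    (C := C1 * C2)
    (F := fun n => Fintype.piFinset fun _ : Fin (k + 1) => Finset.range (n + 1))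
    (fun n s => by
      rw [norm_mul]
      exact mul_le_mul (hC1 n) (hC2 _ _) (norm_nonneg _) hC10)
    (fun s => tendsto_qPoch_mul_qPochRecip hq (s 0))
    (fun n s hs => multiTerm_mul_qPochRecip_eq_zero hs _)
  have hlimS := tendsto_sum_mul hS
    (c := fun n r => qPoch q q n * qPochRecip q n r * qPoch (a * q ^ (n + r + 1)) q (n - r))
    (C := C1 * C2 * (C3 * C4)) (F := fun n => Finset.range (n + 1))
    (fun n r => by
      by_cases hr : r ≤ n
      · rw [hquot n r hr, norm_mul, norm_mul, norm_mul (qPoch (a * q) q (2 * n))]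
        have := hC1 n
        have := hC2 n r
        have := hC3 (2 * n)
        have := hC4 (n + r)
        gcongr
      · rw [qPochRecip_of_lt (by omega), mul_zero, zero_mul, norm_zero]
        positivity)
    (fun r => by
      have h : Tendsto (fun n => qPoch (a * q) q (2 * n) * (qPoch (a * q) q (n + r))⁻¹) atTop
          (𝓝 1) := by
        rw [← mul_inv_cancel₀ hP0]
        exact htwo.mul ((hPlim.comp (tendsto_add_atTop_nat r)).inv₀ hP0)
      have h2 := (tendsto_qPoch_mul_qPochRecip hq r).mul h
      rw [one_mul] at h2
      refine h2.congr' ?_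
      filter_upwards [eventually_ge_atTop r] with n hn
      rw [hquot n r hn])
    (fun n r hr => by
      rw [Finset.mem_range] at hr
      rw [qPochRecip_of_lt (by omega)]
      ring)
  have key : P * ∑' s, multiTerm k a q s = ∑' r, seriesTerm k a q r := by
    refine tendsto_nhds_unique (htwo.mul hlimT) (hlimS.congr fun n => ?_)
    have hfin := sum_multiTerm_eq_sum_seriesTerm hu ha' n
    calc _ = qPoch q q n * ∑ r ∈ Finset.range (n + 1), seriesTerm k a q r *
          (qPochRecip q n r * qPoch (a * q ^ (n + r + 1)) q (n - r)) := by
          rw [Finset.mul_sum]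
          exact Finset.sum_congr rfl fun s _ => by ring
      _ = _ := by
          rw [← hfin, Finset.mul_sum, Finset.mul_sum, Finset.mul_sum]
          exact Finset.sum_congr rfl fun s _ => by ring
  refine ⟨P, ∑' r, seriesTerm k a q r, hProd, hP0.isUnit, hS.of_norm.hasSum, ?_⟩
  rw [← key, ← mul_assoc, Ring.inverse_mul_cancel _ hP0.isUnit, one_mul]
  exact hT.of_norm.hasSum

end Analytic

theorem theorem4p3 (k : ℕ) :
    -- the identity of formal power series in `q` (coefficientwise convergence: `K` is discrete)
    (∀ (K : Type*) [Field K] [TopologicalSpace K] [DiscreteTopology K] (a : K),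
      ∃ P S : K⟦X⟧,
        HasProd (fun n : ℕ => 1 - PowerSeries.C a * PowerSeries.X ^ (n + 1)) P ∧ IsUnit P ∧
        HasSum (fun r : ℕ => seriesTerm k (PowerSeries.C a) PowerSeries.X r) S ∧
        HasSum (fun s : Fin (k + 1) → ℕ => multiTerm k (PowerSeries.C a) PowerSeries.X s)
          (Ring.inverse P * S)) ∧
    -- the identity of convergent series of complex numbers
    (∀ a q : ℂ, ‖q‖ < 1 → (∀ n : ℕ, a * q ^ (n + 1) ≠ 1) →
      ∃ P S : ℂ,
        HasProd (fun n : ℕ => 1 - a * q ^ (n + 1)) P ∧ IsUnit P ∧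
        HasSum (fun r : ℕ => seriesTerm k a q r) S ∧
        HasSum (fun s : Fin (k + 1) → ℕ => multiTerm k a q s) (Ring.inverse P * S)) := by
  exact ⟨fun K _ _ _ a => hasSum_multiTerm_powerSeries k a, hasSum_multiTerm_complex k⟩
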